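/- \textbf{Setting.} Let $\mathbb A\subset\mathbb R^k$ be finite and nonempty, $\Theta\subset\mathbb R^d$ compact and nonempty, and $\mathbb Y\subset\mathbb R^m$ Borel; $\Delta X$ denotes the Borel probability measures on $X$. A single agent chooses actions in $\mathbb A$. The true consequence kernel is $Q:\mathbb A\to\Delta\mathbb Y$, the agent's (possibly misspecified) model is a family of kernels $Q_\theta:\mathbb A\to\Delta\mathbb Y$, $\theta\in\Theta$, and $\pi:\mathbb A\times\mathbb Y\to\mathbb R$ is the measurable per-period payoff. Assume: (i) there is a $\sigma$-finite measure $\nu$ on $\mathbb Y$ such that $Q(\cdot\mid a)$ and $Q_\theta(\cdot\mid a)$ have measurable densities $q(\cdot\mid a)$ and $q_\theta(\cdot\mid a)$ with respect to $\nu$, with $(\theta,a,y)\mapsto q_\theta(y\mid a)$ jointly measurable; for $\nu$-a.e. $y$ the maps $a\mapsto q(y\mid a)$, $(\theta,a)\mapsto q_\theta(y\mid a)$ and $a\mapsto\pi(a,y)$ are continuous; (ii) there are measurable $M:\mathbb Y\to[1,\infty)$ and $r,h:\mathbb Y\to[0,\infty)$ such that for all $\theta,a$ and $\nu$-a.e.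 $y$: $q_\theta(y\mid a)M(y)^{-1}\le q(y\mid a)\le q_\theta(y\mid a)M(y)$, $q(y\mid a)\le r(y)$ and $|\pi(a,y)|\le h(y)$, with $\int M r\,d\nu<\infty$ and $\int h M r\,d\nu<\infty$. \textbf{Definitions.} Put $U(a,\theta)=\int\pi(a,y)\,Q_\theta(dy\mid a)$ and, for $\mu\in\Delta\Theta$, $F(\mu)=\arg\max_{a\in\mathbb A}\int_\Theta U(a,\theta)\,\mu(d\theta)$. Put $K(\theta,a)=\mathrm{KL}\big(Q(\cdot\mid a)\,\Vert\,Q_\theta(\cdot\mid a)\big)$ and, for $\sigma\in\Delta\mathbb A$, $\Theta^{\mathrm m}(\sigma)=\arg\min_{\theta\in\Theta}\int K(\theta,a)\,\sigma(da)$. - $\sigma\in\Delta\mathbb A$ is a \emph{Berk--Nash equilibrium} if there is $\mu\in\Delta\Theta$ with $\operatorname{supp}\sigma\subseteq F(\mu)$ and $\operatorname{supp}\mu\subseteq\Theta^{\mathrm m}(\sigma)$. - \emph{Weak Identification} holds at $\sigma$ if $Q_\theta(\cdot\mid a)=Q_{\theta'}(\cdot\mid a)$ for all $\theta,\theta'\in\Theta^{\mathrm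 m}(\sigma)$ and all $a\in\operatorname{supp}\sigma$. \textbf{Dynamics.} Number the periods $t=0,1,2,\dots$. The agent starts from a prior $\mu_0\in\Delta\Theta$ with full support $\Theta$. In period $t$, given the current belief $\mu_t$, the action $a_t$ is drawn from $\phi_t(\cdot\mid\mu_t)$, where $\phi_t$ is a Markov kernel from $\Delta\Theta$ to $\mathbb A$ with $\phi_t(F(\mu)\mid\mu)=1$ for all $\mu\in\Delta\Theta$ (there are no payoff perturbations); then the consequence $y_t$ is drawn from $Q(\cdot\mid a_t)$, and beliefs are updated by Bayes' rule $$\mu_{t+1}(B)=\frac{\int_B q_\theta(y_t\mid a_t)\,\mu_t(d\theta)}{\int_\Theta q_\theta(y_t\mid a_t)\,\mu_t(d\theta)}$$ (with $\mu_{t+1}=\mu_t$ whenever the denominator is $0$ or $\infty$). Let $\mathbf P$ be the induced probability law on infinite sequences $(a_t,y_t)_{t\ge0}$, and let $\sigma_t=\frac1t\sum_{\tau=0}^{t-1}\delta_{a_\tau}$, $t\ge1$, be the empirical action distribution. \textbf{Proposition.} $\mathbf P$-almost surely, the following holds for every $\sigma\in\Delta\mathbb A$: if $\sigma_t\to\sigma$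 and Weak Identification holds at $\sigma$, then $\sigma$ is a Berk--Nash equilibrium. -/

import Mathlib

open MeasureTheory ProbabilityTheory Filter Topology
open scoped NNReal ENNReal

noncomputable section

/-- The primitives of a single-agent misspecified learning problem with actions `A`, parameters `Θ`
and consequences `Y`: the true consequence kernel `Q`, the subjective kernels `Qm θ`, their
densities `q` and `qm` with respect to a common σ-finite measure `ν`, and the per-period payoff. -/
structure LearningProblem (A Θ Y : Type*) [MeasurableSpace A] [MeasurableSpace Θ]
    [MeasurableSpace Y] where
  /-- the dominating measure -/
  ν : Measure Y
  sigmaFinite_ν : SigmaFinite ν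
  /-- the true consequence kernel -/
  Q : Kernel A Y
  markov_Q : IsMarkovKernel Q
  /-- the subjective consequence kernels -/
  Qm : Θ → Kernel A Y
  markov_Qm : ∀ θ, IsMarkovKernel (Qm θ)
  /-- the density `q(y | a)` -/
  q : A → Y → ℝ≥0
  measurable_q : ∀ a, Measurable (q a)
  Q_eq : ∀ a, Q a = ν.withDensity (fun y => (q a y : ℝ≥0∞))
  /-- the density `q_θ(y | a)` -/
  qm : Θ → A → Y → ℝ≥0
  measurable_qm : Measurable (fun p : Θ × A × Y => qm p.1 p.2.1 p.2.2)
  Qm_eq : ∀ θ a, Qm θ a = ν.withDensity (fun y => (qm θ a y : ℝ≥0∞))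
  /-- the per-period payoff -/
  payoff : A → Y → ℝ
  measurable_payoff : ∀ a, Measurable (payoff a)

namespace LearningProblem

attribute [instance] sigmaFinite_ν markov_Q markov_Qm

variable {A Θ Y : Type*} [MeasurableSpace A] [MeasurableSpace Θ] [MeasurableSpace Y]

/-- The regularity assumptions: almost everywhere continuity of the densities, the likelihood ratio
envelope, and almost everywhere continuity and domination of the payoff. -/
structure Regular [TopologicalSpace A] [TopologicalSpace Θ] (P : LearningProblem A Θ Y) :
    Prop where
  continuous_q : ∀ᵐ y ∂P.ν, Continuous (fun a => P.q a y)
  continuous_qm : ∀ᵐ y ∂P.ν, Continuous (fun p : Θ × A => P.qm p.1 p.2 y)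
  continuous_payoff : ∀ᵐ y ∂P.ν, Continuous (fun a => P.payoff a y)
  envelope : ∃ M r h : Y → ℝ≥0, Measurable M ∧ Measurable r ∧ Measurable h ∧ (∀ y, 1 ≤ M y) ∧
    (∀ θ a, ∀ᵐ y ∂P.ν,
      P.qm θ a y * (M y)⁻¹ ≤ P.q a y ∧ P.q a y ≤ P.qm θ a y * M y ∧ P.q a y ≤ r y) ∧
    (∫⁻ y, (M y : ℝ≥0∞) * r y ∂P.ν) < ∞ ∧
    (∀ a, ∀ᵐ y ∂P.ν, |P.payoff a y| ≤ h y) ∧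
    (∫⁻ y, (h y : ℝ≥0∞) * M y * r y ∂P.ν) < ∞

/-- Expected payoff `U(a, θ)` of action `a` under parameter `θ`. -/
def U (P : LearningProblem A Θ Y) (a : A) (θ : Θ) : ℝ :=
  ∫ y, P.payoff a y ∂(P.Qm θ a)

/-- The optimal action correspondence `F(μ)`. -/
def F (P : LearningProblem A Θ Y) (μ : ProbabilityMeasure Θ) : Set A :=
  {a | ∀ a', ∫ θ, P.U a' θ ∂(μ : Measure Θ) ≤ ∫ θ, P.U a θ ∂(μ : Measure Θ)}

/-- The action-dependent Kullback-Leibler divergence `K(θ, a) = KL(Q(· | a) ‖ Q_θ(· | a))`. -/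
def K (P : LearningProblem A Θ Y) (θ : Θ) (a : A) : ℝ≥0∞ :=
  InformationTheory.klDiv (P.Q a) (P.Qm θ a)

/-- The set of parameters minimizing the `σ`-average Kullback-Leibler divergence. -/
def klMinimizers (P : LearningProblem A Θ Y) (σ : ProbabilityMeasure A) : Set Θ :=
  {θ | ∀ θ', ∫⁻ a, P.K θ a ∂(σ : Measure A) ≤ ∫⁻ a, P.K θ' a ∂(σ : Measure A)}

/-- Berk-Nash equilibrium. -/
def IsBerkNash [TopologicalSpace A] [TopologicalSpace Θ] (P : LearningProblem A Θ Y)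
    (σ : ProbabilityMeasure A) : Prop :=
  ∃ μ : ProbabilityMeasure Θ, (σ : Measure A).support ⊆ P.F μ ∧
    (μ : Measure Θ).support ⊆ P.klMinimizers σ

/-- Weak identification at `σ`. -/
def WeakIdentification [TopologicalSpace A] (P : LearningProblem A Θ Y)
    (σ : ProbabilityMeasure A) : Prop :=
  ∀ θ ∈ P.klMinimizers σ, ∀ θ' ∈ P.klMinimizers σ,
    ∀ a ∈ (σ : Measure A).support, P.Qm θ a = P.Qm θ' a

/-- The normalizing constant `∫ q_θ(y | a) μ(dθ)` of Bayes' rule. -/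
def evidence (P : LearningProblem A Θ Y) (μ : ProbabilityMeasure Θ) (z : A × Y) : ℝ≥0∞ :=
  ∫⁻ θ, (P.qm θ z.1 z.2 : ℝ≥0∞) ∂(μ : Measure Θ)

/-- Bayes' rule `B ↦ ∫_B q_θ(y | a) μ(dθ) / ∫ q_θ(y | a) μ(dθ)` after observing `z = (a, y)`. -/
def bayesPosterior (P : LearningProblem A Θ Y) (μ : ProbabilityMeasure Θ) (z : A × Y)
    (hz : P.evidence μ z ≠ 0 ∧ P.evidence μ z ≠ ∞) : ProbabilityMeasure Θ :=
  ⟨(P.evidence μ z)⁻¹ • (μ : Measure Θ).withDensity (fun θ => (P.qm θ z.1 z.2 : ℝ≥0∞)), ⟨by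
    rw [Measure.smul_apply, withDensity_apply _ MeasurableSet.univ, Measure.restrict_univ,
      smul_eq_mul]
    exact ENNReal.inv_mul_cancel hz.1 hz.2⟩⟩

open Classical in
/-- One step of belief updating: Bayes' rule. If the normalizing constant is zero or infinite, the
belief is left unchanged. -/
def bayesUpdate (P : LearningProblem A Θ Y) (μ : ProbabilityMeasure Θ) (z : A × Y) :
    ProbabilityMeasure Θ :=
  if hz : P.evidence μ z ≠ 0 ∧ P.evidence μ z ≠ ∞ then P.bayesPosterior μ z hz else μ

/-- Along a path `ω` of action-consequence pairs, `posterior μ₀ ω t` is the belief held at the start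
of period `t`, after observing `ω 0, …, ω (t - 1)`; periods are numbered from `0`. -/
def posterior (P : LearningProblem A Θ Y) (μ₀ : ProbabilityMeasure Θ) (ω : ℕ → A × Y) :
    ℕ → ProbabilityMeasure Θ
  | 0 => μ₀
  | t + 1 => P.bayesUpdate (posterior P μ₀ ω t) (ω t)

lemma measurable_lintegral_qm (P : LearningProblem A Θ Y) {B : Set Θ} (hB : MeasurableSet B) :
    Measurable (fun p : ProbabilityMeasure Θ × (A × Y) =>
      ∫⁻ θ in B, (P.qm θ p.2.1 p.2.2 : ℝ≥0∞) ∂(p.1 : Measure Θ)) := by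
  let κ : Kernel (ProbabilityMeasure Θ × (A × Y)) Θ :=
    ⟨fun p => (p.1 : Measure Θ), measurable_subtype_coe.comp measurable_fst⟩
  have : IsMarkovKernel κ := ⟨fun p => p.1.2⟩
  have hf : Measurable (fun x : (ProbabilityMeasure Θ × (A × Y)) × Θ =>
      (P.qm x.2 x.1.2.1 x.1.2.2 : ℝ≥0∞)) :=
    (P.measurable_qm.comp
      (measurable_snd.prodMk (measurable_snd.comp measurable_fst))).coe_nnreal_ennreal
  exact Measurable.setLIntegral_kernel_prod_right (κ := κ)
    (f := fun (p : ProbabilityMeasure Θ × (A × Y)) (θ : Θ) => (P.qm θ p.2.1 p.2.2 : ℝ≥0∞)) hf hB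

lemma measurable_evidence (P : LearningProblem A Θ Y) :
    Measurable (fun p : ProbabilityMeasure Θ × (A × Y) => P.evidence p.1 p.2) := by
  simpa [evidence] using P.measurable_lintegral_qm MeasurableSet.univ

lemma measurable_bayesUpdate (P : LearningProblem A Θ Y) :
    Measurable (fun p : ProbabilityMeasure Θ × (A × Y) => P.bayesUpdate p.1 p.2) := by
  classical
  refine Measurable.subtype_mk
    (h := fun p : ProbabilityMeasure Θ × (A × Y) => (P.bayesUpdate p.1 p.2).2) ?_
  refine Measure.measurable_of_measurable_coe _ fun B hB => ?_
  have hset : MeasurableSet {p : ProbabilityMeasure Θ × (A × Y) |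
      P.evidence p.1 p.2 ≠ 0 ∧ P.evidence p.1 p.2 ≠ ∞} :=
    (P.measurable_evidence (measurableSet_singleton (0 : ℝ≥0∞)).compl).inter
      (P.measurable_evidence (measurableSet_singleton ∞).compl)
  have h1 : Measurable (fun p : ProbabilityMeasure Θ × (A × Y) => (p.1 : Measure Θ) B) :=
    (Measure.measurable_coe hB).comp (measurable_subtype_coe.comp measurable_fst)
  let d : DecidablePred fun p : ProbabilityMeasure Θ × (A × Y) =>
      P.evidence p.1 p.2 ≠ 0 ∧ P.evidence p.1 p.2 ≠ ∞ := Classical.decPred _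
  have h2 := @Measurable.ite _ _ _ _ _ _ _ d hset
    (P.measurable_evidence.inv.mul (P.measurable_lintegral_qm hB)) h1
  convert! h2 using 1
  funext p
  by_cases hp : P.evidence p.1 p.2 ≠ 0 ∧ P.evidence p.1 p.2 ≠ ∞
  · have e : ((P.bayesUpdate p.1 p.2 : ProbabilityMeasure Θ) : Measure Θ) =
        (P.evidence p.1 p.2)⁻¹ •
          (p.1 : Measure Θ).withDensity (fun θ => (P.qm θ p.2.1 p.2.2 : ℝ≥0∞)) := by
      rw [bayesUpdate, dif_pos hp]; rfl
    rw [if_pos hp]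
    refine (congrArg (fun m : Measure Θ => m B) e).trans ?_
    simp only [Measure.smul_apply, withDensity_apply _ hB, smul_eq_mul, Pi.mul_apply, Pi.inv_apply]
  · have e : P.bayesUpdate p.1 p.2 = p.1 := by rw [bayesUpdate, dif_neg hp]
    rw [if_neg hp]
    exact congrArg (fun m : ProbabilityMeasure Θ => (m : Measure Θ) B) e

/-- A finite history `(z_0, …, z_n)`, prolonged to a path by repeating its last entry. -/
def prolong (n : ℕ) (h : (i : Finset.Iic n) → A × Y) : ℕ → A × Y :=
  fun i => h ⟨min i n, Finset.mem_Iic.2 (min_le_right i n)⟩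

lemma measurable_posterior (P : LearningProblem A Θ Y) (μ₀ : ProbabilityMeasure Θ) (t : ℕ) :
    Measurable (fun ω : ℕ → A × Y => P.posterior μ₀ ω t) := by
  induction t with
  | zero => exact measurable_const
  | succ t ih => exact P.measurable_bayesUpdate.comp (ih.prodMk (measurable_pi_apply t))

lemma measurable_prolong (n : ℕ) : Measurable (prolong (A := A) (Y := Y) n) :=
  measurable_pi_lambda _ fun _ => measurable_pi_apply _

/-- The conditional law of the pair `(a_{n+1}, y_{n+1})` given the history `(a_0, y_0, …, a_n, y_n)`:
the action is drawn from the selection rule evaluated at the current posterior, and then the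
consequence is drawn from the true kernel at that action. -/
def stepKernel (P : LearningProblem A Θ Y) (μ₀ : ProbabilityMeasure Θ)
    (φ : ℕ → Kernel (ProbabilityMeasure Θ) A) (n : ℕ) :
    Kernel ((i : Finset.Iic n) → A × Y) (A × Y) :=
  ((φ (n + 1)).comap (fun h => P.posterior μ₀ (prolong n h) (n + 1))
    ((P.measurable_posterior μ₀ (n + 1)).comp (measurable_prolong n))) ⊗ₖ
      (P.Q.comap Prod.snd measurable_snd)

instance (P : LearningProblem A Θ Y) (μ₀ : ProbabilityMeasure Θ)
    (φ : ℕ → Kernel (ProbabilityMeasure Θ) A) [∀ t, IsMarkovKernel (φ t)] (n : ℕ) :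
    IsMarkovKernel (P.stepKernel μ₀ φ n) := by
  unfold stepKernel; infer_instance

/-- The probability law induced by the prior `μ₀`, the selection rules `φ` and the true kernel on
infinite sequences of actions and consequences. -/
def law (P : LearningProblem A Θ Y) (μ₀ : ProbabilityMeasure Θ)
    (φ : ℕ → Kernel (ProbabilityMeasure Θ) A) [∀ t, IsMarkovKernel (φ t)] :
    Measure (ℕ → A × Y) :=
  Kernel.trajMeasure (X := fun _ => A × Y) ((φ 0 μ₀) ⊗ₘ P.Q) (P.stepKernel μ₀ φ)

/-- The rules `φ t` choose an optimal action with probability one, whatever the belief. -/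
def IsOptimalSelection (P : LearningProblem A Θ Y)
    (φ : ℕ → Kernel (ProbabilityMeasure Θ) A) : Prop :=
  ∀ t μ, φ t μ (P.F μ) = 1

end LearningProblem

/-- The empirical distribution of the actions in the first `n + 1` periods. -/
def empiricalActions {A Y : Type*} [MeasurableSpace A] (ω : ℕ → A × Y) (n : ℕ) :
    ProbabilityMeasure A :=
  ⟨((n + 1 : ℕ) : ℝ≥0∞)⁻¹ • ∑ i ∈ Finset.range (n + 1), Measure.dirac (ω i).1, ⟨by
    simp only [Measure.smul_apply, Measure.finsetSum_apply, measure_univ, Finset.sum_const,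
      Finset.card_range, nsmul_eq_mul, mul_one, smul_eq_mul]
    exact ENNReal.inv_mul_cancel (by simp) (ENNReal.natCast_ne_top _)⟩⟩

end

section OrthogonalStrongLaw

variable {Ω : Type*} [MeasurableSpace Ω] {μ : Measure Ω} {X : ℕ → Ω → ℝ} {C : ℝ}

lemma integral_sq_sum_le_of_orthogonal (hL : ∀ i, MemLp (X i) 2 μ)
    (hC : ∀ i, ∫ ω, X i ω ^ 2 ∂μ ≤ C) (horth : ∀ i j, i < j → ∫ ω, X i ω * X j ω ∂μ = 0)
    (s : Finset ℕ) :
    ∫ ω, (∑ i ∈ s, X i ω) ^ 2 ∂μ ≤ s.card * C := by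
  have hint : ∀ i j, Integrable (fun ω => X i ω * X j ω) μ :=
    fun i j => (hL i).integrable_mul (hL j)
  have h1 : ∀ ω, (∑ i ∈ s, X i ω) ^ 2 = ∑ i ∈ s, ∑ j ∈ s, X i ω * X j ω := fun ω => by
    rw [sq, Finset.sum_mul_sum]
  simp_rw [h1]
  rw [integral_finsetSum _ fun i _ => integrable_finsetSum _ fun j _ => hint i j]
  rw [← nsmul_eq_mul]
  refine Finset.sum_le_card_nsmul _ _ _ fun i hi => ?_
  rw [integral_finsetSum _ fun j _ => hint i j, Finset.sum_eq_single_of_mem i hi]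
  · simpa [sq] using hC i
  · intro j _ hj
    rcases lt_or_gt_of_ne hj with h | h
    · simpa [mul_comm] using horth j i h
    · exact horth i j h

lemma lintegral_sq_sum_le_of_orthogonal (hL : ∀ i, MemLp (X i) 2 μ)
    (hC : ∀ i, ∫ ω, X i ω ^ 2 ∂μ ≤ C) (horth : ∀ i j, i < j → ∫ ω, X i ω * X j ω ∂μ = 0)
    (s : Finset ℕ) :
    ∫⁻ ω, ENNReal.ofReal ((∑ i ∈ s, X i ω) ^ 2) ∂μ ≤ ENNReal.ofReal (s.card * C) := by
  rw [← ofReal_integral_eq_lintegral_ofReal]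
  · exact ENNReal.ofReal_le_ofReal (integral_sq_sum_le_of_orthogonal hL hC horth s)
  · exact (memLp_finsetSum s fun i _ => hL i).integrable_sq
  · exact ae_of_all _ fun ω => sq_nonneg _

/-- The strong law of large numbers for orthogonal random variables with bounded second moments. -/
theorem strong_law_of_orthogonal (hm : ∀ i, Measurable (X i)) (hL : ∀ i, MemLp (X i) 2 μ)
    (hC : ∀ i, ∫ ω, X i ω ^ 2 ∂μ ≤ C) (horth : ∀ i j, i < j → ∫ ω, X i ω * X j ω ∂μ = 0) :
    ∀ᵐ ω ∂μ, Tendsto (fun n : ℕ => (∑ i ∈ Finset.range n, X i ω) / n) atTop (𝓝 0) := by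
  have hC0 : 0 ≤ C := (integral_nonneg fun ω => sq_nonneg _).trans (hC 0)
  let W : ℕ → Ω → ℝ := fun n ω => (∑ i ∈ Finset.range (n ^ 2), X i ω) ^ 2 +
    ∑ m ∈ Finset.Ico (n ^ 2) ((n + 1) ^ 2), (∑ i ∈ Finset.Ico (n ^ 2) m, X i ω) ^ 2
  have hW0 : ∀ n ω, 0 ≤ W n ω := fun n ω =>
    add_nonneg (sq_nonneg _) (Finset.sum_nonneg fun _ _ => sq_nonneg _)
  have hSm : ∀ s : Finset ℕ, Measurable fun ω => (∑ i ∈ s, X i ω) ^ 2 := fun s =>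
    (Finset.measurable_fun_sum s fun i _ => hm i).pow_const 2
  have hWm : ∀ n, Measurable (W n) := fun n =>
    (hSm _).add (Finset.measurable_fun_sum _ fun i _ => hSm _)
  have hWint : ∀ n, ∫⁻ ω, ENNReal.ofReal (W n ω) ∂μ ≤ ENNReal.ofReal (5 * (n + 1) ^ 2 * C) := by
    intro n
    have e : ∀ ω, ENNReal.ofReal (W n ω) =
        ENNReal.ofReal ((∑ i ∈ Finset.range (n ^ 2), X i ω) ^ 2) +
        ∑ m ∈ Finset.Ico (n ^ 2) ((n + 1) ^ 2),
          ENNReal.ofReal ((∑ i ∈ Finset.Ico (n ^ 2) m, X i ω) ^ 2) := by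
      intro ω
      rw [ENNReal.ofReal_add (sq_nonneg _) (Finset.sum_nonneg fun _ _ => sq_nonneg _),
        ENNReal.ofReal_sum_of_nonneg fun _ _ => sq_nonneg _]
    simp_rw [e]
    rw [lintegral_add_left (hSm _).ennreal_ofReal,
      lintegral_finsetSum _ fun m _ => (hSm _).ennreal_ofReal]
    have hb : ∀ m ∈ Finset.Ico (n ^ 2) ((n + 1) ^ 2),
        ∫⁻ ω, ENNReal.ofReal ((∑ i ∈ Finset.Ico (n ^ 2) m, X i ω) ^ 2) ∂μ ≤
          ENNReal.ofReal ((2 * n + 1) * C) := by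
      intro m hmem
      refine (lintegral_sq_sum_le_of_orthogonal hL hC horth _).trans
        (ENNReal.ofReal_le_ofReal (mul_le_mul_of_nonneg_right ?_ hC0))
      rw [Finset.mem_Ico] at hmem
      have h2 : m - n ^ 2 ≤ 2 * n + 1 := by
        have : (n + 1) ^ 2 = n ^ 2 + 2 * n + 1 := by ring
        omega
      rw [Nat.card_Ico]
      exact_mod_cast h2
    refine (add_le_add (lintegral_sq_sum_le_of_orthogonal hL hC horth _)
      (Finset.sum_le_card_nsmul _ _ _ hb)).trans ?_
    have h3 : (n + 1) ^ 2 - n ^ 2 = 2 * n + 1 := by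
      have : (n + 1) ^ 2 = n ^ 2 + 2 * n + 1 := by ring
      omega
    rw [Nat.card_Ico, h3, nsmul_eq_mul, ← ENNReal.ofReal_natCast,
      ← ENNReal.ofReal_mul (by positivity), ← ENNReal.ofReal_add (by positivity) (by positivity)]
    apply ENNReal.ofReal_le_ofReal
    rw [Finset.card_range]
    push_cast
    nlinarith [mul_nonneg hC0 (Nat.cast_nonneg (α := ℝ) n)]
  have hsum : ∫⁻ ω, ∑' n : ℕ, ENNReal.ofReal (W n ω / (n + 1) ^ 4) ∂μ ≠ ∞ := by
    rw [lintegral_tsum fun n => ((hWm n).div_const _).ennreal_ofReal.aemeasurable]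
    have hs : Summable fun n : ℕ => 5 * C * (1 / ((n : ℝ) + 1) ^ 2) := by
      have := (summable_nat_add_iff 1).2 (Real.summable_one_div_nat_pow.2 one_lt_two)
      exact (by simpa using this : Summable fun n : ℕ => (1 / ((n : ℝ) + 1) ^ 2)).mul_left _
    refine ne_top_of_le_ne_top hs.tsum_ofReal_ne_top (ENNReal.tsum_le_tsum fun n => ?_)
    have e : ∀ ω, ENNReal.ofReal (W n ω / (n + 1) ^ 4) =
        ENNReal.ofReal (1 / ((n : ℝ) + 1) ^ 4) * ENNReal.ofReal (W n ω) := by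
      intro ω
      rw [← ENNReal.ofReal_mul (by positivity)]
      congr 1
      ring
    simp_rw [e]
    rw [lintegral_const_mul _ (hWm n).ennreal_ofReal]
    refine (mul_le_mul_right (hWint n) _).trans ?_
    rw [← ENNReal.ofReal_mul (by positivity)]
    apply ENNReal.ofReal_le_ofReal
    apply le_of_eq
    field_simp
  have hae := ae_lt_top
    (Measurable.tsum fun n => ((hWm n).div_const (((n : ℝ) + 1) ^ 4)).ennreal_ofReal) hsum
  filter_upwards [hae] with ω hω
  have h1 := ENNReal.tendsto_atTop_zero_of_tsum_ne_top hω.ne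
  have h2 : Tendsto (fun n : ℕ => W n ω / ((n : ℝ) + 1) ^ 4) atTop (𝓝 0) := by
    have := (ENNReal.tendsto_toReal ENNReal.zero_ne_top).comp h1
    simp only [ENNReal.toReal_zero] at this
    refine this.congr fun n => ?_
    rw [Function.comp_apply, ENNReal.toReal_ofReal (div_nonneg (hW0 n ω) (by positivity))]
  have hsqrt : Tendsto Nat.sqrt atTop atTop :=
    tendsto_atTop_atTop.2 fun b => ⟨b * b, fun a ha => Nat.le_sqrt.2 ha⟩
  have h3 : Tendsto (fun m : ℕ => ((∑ i ∈ Finset.range m, X i ω) / m) ^ 2) atTop (𝓝 0) := by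
    have h4 := (h2.comp hsqrt).const_mul 32
    rw [mul_zero] at h4
    refine squeeze_zero' (Eventually.of_forall fun m => sq_nonneg _) ?_ h4
    filter_upwards [eventually_ge_atTop 1] with m hm1
    simp only [Function.comp_apply]
    set n := Nat.sqrt m
    have hn1 : 1 ≤ n := Nat.le_sqrt.2 (by simpa using hm1)
    have hnm : n ^ 2 ≤ m := by simpa [sq] using Nat.sqrt_le m
    have hmn : m < (n + 1) ^ 2 := by simpa [sq] using Nat.lt_succ_sqrt m
    have hsplit : ∑ i ∈ Finset.range m, X i ω =
        ∑ i ∈ Finset.range (n ^ 2), X i ω + ∑ i ∈ Finset.Ico (n ^ 2) m, X i ω :=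
      (Finset.sum_range_add_sum_Ico _ hnm).symm
    have hle : (∑ i ∈ Finset.Ico (n ^ 2) m, X i ω) ^ 2 ≤
        ∑ m ∈ Finset.Ico (n ^ 2) ((n + 1) ^ 2), (∑ i ∈ Finset.Ico (n ^ 2) m, X i ω) ^ 2 :=
      Finset.single_le_sum (f := fun m => (∑ i ∈ Finset.Ico (n ^ 2) m, X i ω) ^ 2)
        (fun _ _ => sq_nonneg _) (Finset.mem_Ico.2 ⟨hnm, hmn⟩)
    have hS : (∑ i ∈ Finset.range m, X i ω) ^ 2 ≤ 2 * W n ω := by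
      rw [hsplit]
      refine (add_sq_le).trans ?_
      exact mul_le_mul_of_nonneg_left (add_le_add le_rfl hle) zero_le_two
    have hn1' : (1 : ℝ) ≤ n := by exact_mod_cast hn1
    have hm' : ((n : ℝ) + 1) ^ 4 ≤ 16 * (m : ℝ) ^ 2 := by
      have hnm' : (n : ℝ) ^ 2 ≤ m := by exact_mod_cast hnm
      have h5 : ((n : ℝ) + 1) ^ 2 ≤ 4 * m := by nlinarith
      calc ((n : ℝ) + 1) ^ 4 = (((n : ℝ) + 1) ^ 2) ^ 2 := by ring
        _ ≤ (4 * (m : ℝ)) ^ 2 := by gcongr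
        _ = 16 * (m : ℝ) ^ 2 := by ring
    have hm0 : (0 : ℝ) < m := by exact_mod_cast hm1
    rw [div_pow, div_le_iff₀ (by positivity)]
    calc _ ≤ 2 * W n ω := hS
      _ = 2 * (W n ω / ((n : ℝ) + 1) ^ 4) * ((n : ℝ) + 1) ^ 4 := by field_simp
      _ ≤ 2 * (W n ω / ((n : ℝ) + 1) ^ 4) * (16 * (m : ℝ) ^ 2) := by
        have := div_nonneg (hW0 n ω) (by positivity : (0 : ℝ) ≤ ((n : ℝ) + 1) ^ 4)
        gcongr
      _ = _ := by ring
  have h5 := (Real.continuous_sqrt.tendsto 0).comp h3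
  rw [Real.sqrt_zero] at h5
  exact (tendsto_zero_iff_abs_tendsto_zero _).2 (h5.congr fun m => Real.sqrt_sq_eq_abs _)

end OrthogonalStrongLaw

namespace LearningProblem

variable {A Θ Y : Type*} [MeasurableSpace A] [MeasurableSpace Θ] [MeasurableSpace Y]

lemma posterior_congr (P : LearningProblem A Θ Y) (μ₀ : ProbabilityMeasure Θ)
    {ω ω' : ℕ → A × Y} {t : ℕ} (h : ∀ i < t, ω i = ω' i) :
    P.posterior μ₀ ω t = P.posterior μ₀ ω' t := by
  induction t with
  | zero => rfl
  | succ t ih =>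
    rw [posterior, posterior, ih fun i hi => h i (hi.trans t.lt_succ_self), h t t.lt_succ_self]

lemma posterior_prolong (P : LearningProblem A Θ Y) (μ₀ : ProbabilityMeasure Θ)
    (ω : ℕ → A × Y) (n : ℕ) :
    P.posterior μ₀ (prolong n (Preorder.frestrictLe n ω)) (n + 1) = P.posterior μ₀ ω (n + 1) :=
  P.posterior_congr μ₀ fun i hi => by
    simp [prolong, Nat.min_eq_left (Nat.le_of_lt_succ hi)]

variable (P : LearningProblem A Θ Y) (μ₀ : ProbabilityMeasure Θ)
  (φ : ℕ → Kernel (ProbabilityMeasure Θ) A) [∀ t, IsMarkovKernel (φ t)]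

instance isProbabilityMeasure_law : IsProbabilityMeasure (P.law μ₀ φ) := by
  unfold law; infer_instance

lemma map_law_succ (n : ℕ) :
    (P.law μ₀ φ).map (fun ω => (Preorder.frestrictLe (π := fun _ => A × Y) n ω, ω (n + 1))) =
      (P.law μ₀ φ).map (Preorder.frestrictLe (π := fun _ => A × Y) n) ⊗ₘ P.stepKernel μ₀ φ n :=
  (Kernel.map_frestrictLe_trajMeasure_compProd_eq_map_trajMeasure
    (X := fun _ => A × Y) (κ := P.stepKernel μ₀ φ)).symm

lemma map_law_zero : (P.law μ₀ φ).map (fun ω => ω 0) = (φ 0 μ₀) ⊗ₘ P.Q := by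
  have h : (P.law μ₀ φ).map (Preorder.frestrictLe (π := fun _ => A × Y) 0) =
      ((φ 0 μ₀) ⊗ₘ P.Q).map (MeasurableEquiv.piUnique
        (fun _ : Finset.Iic 0 => A × Y)).symm := by
    rw [law, Kernel.trajMeasure, Measure.map_comp _ _ (by fun_prop),
      Kernel.traj_map_frestrictLe_of_le le_rfl, Measure.deterministic_comp_eq_map]
    exact Measure.map_id
  have h2 : (fun ω : ℕ → A × Y => ω 0) = (MeasurableEquiv.piUnique
        (fun _ : Finset.Iic 0 => A × Y)) ∘ (Preorder.frestrictLe (π := fun _ => A × Y) 0) := rfl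
  rw [h2, ← Measure.map_map (by fun_prop) (by fun_prop), h,
    Measure.map_map (by fun_prop) (by fun_prop), MeasurableEquiv.self_comp_symm, Measure.map_id]

variable {P μ₀ φ}

lemma lintegral_stepKernel_le {n : ℕ} {g : A × Y → ℝ≥0∞} (hg : Measurable g) {C : ℝ≥0∞}
    (hC : ∀ a, ∫⁻ y, g (a, y) ∂(P.Q a) ≤ C) (h : (i : Finset.Iic n) → A × Y) :
    ∫⁻ z, g z ∂(P.stepKernel μ₀ φ n h) ≤ C := by
  rw [stepKernel, Kernel.lintegral_compProd _ _ _ hg]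
  refine (lintegral_mono fun a => ?_).trans (by simp : ∫⁻ _, C ∂_ ≤ C)
  exact hC a

lemma lintegral_law_le {g : A × Y → ℝ≥0∞} (hg : Measurable g) {C : ℝ≥0∞}
    (hC : ∀ a, ∫⁻ y, g (a, y) ∂(P.Q a) ≤ C) (n : ℕ) :
    ∫⁻ ω, g (ω n) ∂(P.law μ₀ φ) ≤ C := by
  cases n with
  | zero =>
    rw [← lintegral_map hg (measurable_pi_apply 0), map_law_zero, Measure.lintegral_compProd hg]
    exact (lintegral_mono hC).trans (by simp)
  | succ n =>
    have hg2 : Measurable fun p : ((i : Finset.Iic n) → A × Y) × (A × Y) => g p.2 :=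
      hg.comp measurable_snd
    have e : ∫⁻ ω, g (ω (n + 1)) ∂(P.law μ₀ φ) = ∫⁻ p, g p.2 ∂((P.law μ₀ φ).map
        (fun ω => (Preorder.frestrictLe (π := fun _ => A × Y) n ω, ω (n + 1)))) := by
      rw [lintegral_map hg2 (by fun_prop)]
    rw [e, map_law_succ, Measure.lintegral_compProd hg2]
    refine (lintegral_mono fun h => lintegral_stepKernel_le hg hC h).trans ?_
    have : IsProbabilityMeasure
        ((P.law μ₀ φ).map (Preorder.frestrictLe (π := fun _ => A × Y) n)) :=
      Measure.isProbabilityMeasure_map (by fun_prop)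
    simp

lemma ae_law_mem {S : Set (A × Y)} (hS : MeasurableSet S)
    (h : ∀ a, ∀ᵐ y ∂(P.Q a), (a, y) ∈ S) : ∀ᵐ ω ∂(P.law μ₀ φ), ∀ n, ω n ∈ S := by
  refine ae_all_iff.2 fun n => ?_
  have hm : Measurable (Sᶜ.indicator (1 : A × Y → ℝ≥0∞)) := measurable_one.indicator hS.compl
  have h0 : ∫⁻ ω, Sᶜ.indicator 1 (ω n) ∂(P.law μ₀ φ) ≤ 0 := by
    refine lintegral_law_le hm (fun a => ?_) n
    rw [nonpos_iff_eq_zero, lintegral_eq_zero_iff (f := fun y => Sᶜ.indicator 1 (a, y))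
      (hm.comp measurable_prodMk_left)]
    filter_upwards [h a] with y hy
    simp [hy]
  rw [nonpos_iff_eq_zero, lintegral_eq_zero_iff (f := fun ω : ℕ → A × Y => Sᶜ.indicator 1 (ω n))
    (hm.comp (measurable_pi_apply n))] at h0
  filter_upwards [h0] with ω hω
  by_contra hn
  simp [hn] at hω

lemma integral_stepKernel_eq_zero {n : ℕ} {f : A × Y → ℝ}
    (h0 : ∀ a, ∫ y, f (a, y) ∂(P.Q a) = 0) (h : (i : Finset.Iic n) → A × Y) :
    ∫ z, f z ∂(P.stepKernel μ₀ φ n h) = 0 := by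
  by_cases hf : Integrable f (P.stepKernel μ₀ φ n h)
  · rw [stepKernel] at hf ⊢
    rw [integral_compProd hf]
    exact (integral_congr_ae (ae_of_all _ fun a => h0 a)).trans (integral_zero _ _)
  · exact integral_undef hf

lemma integral_law_mul_eq_zero {f : A × Y → ℝ} (hf : Measurable f)
    (h0 : ∀ a, ∫ y, f (a, y) ∂(P.Q a) = 0) {i j : ℕ} (hij : i < j) :
    ∫ ω, f (ω i) * f (ω j) ∂(P.law μ₀ φ) = 0 := by
  obtain ⟨n, rfl⟩ : ∃ n, j = n + 1 := ⟨j - 1, by omega⟩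
  by_cases hint : Integrable (fun ω => f (ω i) * f (ω (n + 1))) (P.law μ₀ φ)
  swap
  · exact integral_undef hint
  let G : ((k : Finset.Iic n) → A × Y) × (A × Y) → ℝ :=
    fun p => f (p.1 ⟨i, Finset.mem_Iic.2 (Nat.le_of_lt_succ hij)⟩) * f p.2
  have hG : Measurable G :=
    (hf.comp ((measurable_pi_apply _).comp measurable_fst)).mul (hf.comp measurable_snd)
  have hmap : Measurable (fun ω : ℕ → A × Y =>
    (Preorder.frestrictLe (π := fun _ => A × Y) n ω, ω (n + 1))) := by fun_prop
  have hGint : Integrable G ((P.law μ₀ φ).map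
      (fun ω => (Preorder.frestrictLe (π := fun _ => A × Y) n ω, ω (n + 1)))) :=
    (integrable_map_measure hG.aestronglyMeasurable hmap.aemeasurable).2 hint
  have e : ∫ ω, f (ω i) * f (ω (n + 1)) ∂(P.law μ₀ φ) = ∫ p, G p ∂((P.law μ₀ φ).map
      (fun ω => (Preorder.frestrictLe (π := fun _ => A × Y) n ω, ω (n + 1)))) :=
    (integral_map hmap.aemeasurable hG.aestronglyMeasurable).symm
  rw [map_law_succ] at e hGint
  rw [e, Measure.integral_compProd hGint]
  refine (integral_congr_ae (ae_of_all _ fun h => ?_)).trans (integral_zero _ _)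
  simp only [G]
  rw [integral_const_mul, integral_stepKernel_eq_zero h0, mul_zero]

lemma memLp_two_law {f : A × Y → ℝ} (hf : Measurable f) {C : ℝ≥0}
    (hC : ∀ a, ∫⁻ y, ENNReal.ofReal (f (a, y) ^ 2) ∂(P.Q a) ≤ C) (n : ℕ) :
    MemLp (fun ω => f (ω n)) 2 (P.law μ₀ φ) ∧ ∫ ω, f (ω n) ^ 2 ∂(P.law μ₀ φ) ≤ C := by
  have hle := lintegral_law_le (μ₀ := μ₀) (φ := φ) (hf.pow_const 2).ennreal_ofReal hC n
  have hfn : Measurable fun ω : ℕ → A × Y => f (ω n) := hf.comp (measurable_pi_apply n)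
  constructor
  · rw [memLp_two_iff_integrable_sq hfn.aestronglyMeasurable]
    refine ⟨(hfn.pow_const 2).aestronglyMeasurable, ?_⟩
    rw [hasFiniteIntegral_iff_ofReal (ae_of_all _ fun _ => sq_nonneg _)]
    exact hle.trans_lt ENNReal.coe_lt_top
  · rw [integral_eq_lintegral_of_nonneg_ae (ae_of_all _ fun _ => sq_nonneg _)
      (hfn.pow_const 2).aestronglyMeasurable]
    exact ENNReal.toReal_le_of_le_ofReal C.2 (by simpa using hle)

/-- The strong law of large numbers for the consequences, conditionally on the actions. -/
theorem strong_law_consequences [Finite A] [MeasurableSingletonClass A] {f : A × Y → ℝ}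
    (hf : Measurable f) (hL : ∀ a, MemLp (fun y => f (a, y)) 2 (P.Q a)) :
    ∀ᵐ ω ∂(P.law μ₀ φ), Tendsto (fun n : ℕ => (∑ i ∈ Finset.range n,
      (f (ω i) - ∫ y, f ((ω i).1, y) ∂(P.Q (ω i).1))) / n) atTop (𝓝 0) := by
  let f' : A × Y → ℝ := fun z => f z - ∫ y, f (z.1, y) ∂(P.Q z.1)
  have hf' : Measurable f' := by
    refine hf.sub ?_
    exact (measurable_of_countable fun a => ∫ y, f (a, y) ∂(P.Q a)).comp measurable_fst
  have hL' : ∀ a, MemLp (fun y => f' (a, y)) 2 (P.Q a) := fun a =>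
    (hL a).sub (memLp_const (∫ y, f (a, y) ∂(P.Q a)))
  have h0 : ∀ a, ∫ y, f' (a, y) ∂(P.Q a) = 0 := by
    intro a
    simp only [f']
    rw [integral_sub ((hL a).integrable one_le_two) (integrable_const _)]
    simp
  have hfin : ∀ a, ∫⁻ y, ENNReal.ofReal (f' (a, y) ^ 2) ∂(P.Q a) < ∞ := by
    intro a
    rw [← hasFiniteIntegral_iff_ofReal (ae_of_all _ fun _ => sq_nonneg _)]
    exact (hL' a).integrable_sq.2
  obtain ⟨C, hC⟩ : ∃ C : ℝ≥0, ∀ a, ∫⁻ y, ENNReal.ofReal (f' (a, y) ^ 2) ∂(P.Q a) ≤ C := by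
    have := Fintype.ofFinite A
    refine ⟨∑ a, (∫⁻ y, ENNReal.ofReal (f' (a, y) ^ 2) ∂(P.Q a)).toNNReal, fun a => ?_⟩
    rw [← ENNReal.coe_toNNReal (hfin a).ne, ENNReal.coe_le_coe]
    exact Finset.single_le_sum
      (f := fun a => (∫⁻ y, ENNReal.ofReal (f' (a, y) ^ 2) ∂(P.Q a)).toNNReal)
      (fun _ _ => zero_le) (Finset.mem_univ a)
  exact strong_law_of_orthogonal (fun i => hf'.comp (measurable_pi_apply i))
    (fun i => (memLp_two_law hf' hC i).1) (fun i => (memLp_two_law hf' hC i).2)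
    (fun i j hij => integral_law_mul_eq_zero hf' h0 hij)

lemma measurableSet_mem_F [Countable A] (hU : ∀ a, Measurable (P.U a)) (a : A) :
    MeasurableSet {μ | a ∈ P.F μ} := by
  let κ : Kernel (ProbabilityMeasure Θ) Θ := ⟨fun p => (p : Measure Θ), measurable_subtype_coe⟩
  have : IsMarkovKernel κ := ⟨fun p => p.2⟩
  have hm : ∀ a, Measurable fun μ : ProbabilityMeasure Θ => ∫ θ, P.U a θ ∂(μ : Measure Θ) :=
    fun a => ((hU a).stronglyMeasurable.integral_kernel (κ := κ)).measurable
  have e : {μ | a ∈ P.F μ} = ⋂ a', {μ : ProbabilityMeasure Θ |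
      ∫ θ, P.U a' θ ∂(μ : Measure Θ) ≤ ∫ θ, P.U a θ ∂(μ : Measure Θ)} := by
    ext μ; simp [F]
  rw [e]
  exact MeasurableSet.iInter fun a' => measurableSet_le (hm a') (hm a)

/-- Almost surely, every action is optimal given the current belief. -/
lemma ae_law_mem_F [Countable A] [MeasurableSingletonClass A] (hU : ∀ a, Measurable (P.U a))
    (hφ : P.IsOptimalSelection φ) :
    ∀ᵐ ω ∂(P.law μ₀ φ), ∀ n, (ω n).1 ∈ P.F (P.posterior μ₀ ω n) := by
  have hae : ∀ t μ, ∀ᵐ a ∂(φ t μ), a ∈ P.F μ := fun t μ =>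
    (prob_compl_eq_zero_iff (Set.to_countable _).measurableSet).2 (hφ t μ)
  have hS : MeasurableSet {p : ProbabilityMeasure Θ × A | p.2 ∈ P.F p.1} := by
    have e : {p : ProbabilityMeasure Θ × A | p.2 ∈ P.F p.1} =
        ⋃ a, {μ | a ∈ P.F μ} ×ˢ {a} := by
      ext ⟨μ, a⟩; simp
    rw [e]
    exact MeasurableSet.iUnion fun a => (measurableSet_mem_F hU a).prod (measurableSet_singleton a)
  refine ae_all_iff.2 fun n => ?_
  cases n with
  | zero =>
    have h1 : ∀ᵐ z ∂((P.law μ₀ φ).map (fun ω => ω 0)), z.1 ∈ P.F μ₀ := by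
      rw [map_law_zero]
      exact Measure.ae_compProd_of_ae_fst _ (Set.to_countable _).measurableSet (hae 0 μ₀)
    exact ae_of_ae_map (measurable_pi_apply 0).aemeasurable h1
  | succ n =>
    let β : ((i : Finset.Iic n) → A × Y) → ProbabilityMeasure Θ :=
      fun h => P.posterior μ₀ (prolong n h) (n + 1)
    have hβ : Measurable β := (P.measurable_posterior μ₀ (n + 1)).comp (measurable_prolong n)
    have h1 : ∀ᵐ p ∂((P.law μ₀ φ).map
        (fun ω => (Preorder.frestrictLe (π := fun _ => A × Y) n ω, ω (n + 1)))),
        p.2.1 ∈ P.F (β p.1) := by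
      rw [map_law_succ]
      refine Measure.ae_compProd_of_ae_ae ?_ (ae_of_all _ fun h => ?_)
      · exact hS.preimage ((hβ.comp measurable_fst).prodMk (measurable_fst.comp measurable_snd))
      · rw [stepKernel]
        refine Kernel.ae_compProd_of_ae_ae
          (measurable_fst (Set.to_countable (P.F (β h))).measurableSet) ?_
        filter_upwards [hae (n + 1) (β h)] with a ha using ae_of_all _ fun y => ha
    have h2 := ae_of_ae_map (f := fun ω : ℕ → A × Y =>
      (Preorder.frestrictLe (π := fun _ => A × Y) n ω, ω (n + 1)))
      (Measurable.aemeasurable (by fun_prop)) h1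
    filter_upwards [h2] with ω hω
    simpa only [β, posterior_prolong] using hω

end LearningProblem

namespace LearningProblem

lemma ae_forall_of_denseSeq {Θ Y : Type*} [MeasurableSpace Y] [TopologicalSpace Θ]
    [TopologicalSpace.SeparableSpace Θ] [Nonempty Θ]
    {ν : Measure Y} {p : Θ → Y → Prop} (h : ∀ θ, ∀ᵐ y ∂ν, p θ y)
    (hc : ∀ᵐ y ∂ν, IsClosed {θ | p θ y}) : ∀ᵐ y ∂ν, ∀ θ, p θ y := by
  filter_upwards [ae_all_iff.2 fun n => h (TopologicalSpace.denseSeq Θ n), hc] with y hy hcy θ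
  exact (TopologicalSpace.denseRange_denseSeq Θ).induction_on θ hcy hy

variable {A Θ Y : Type*} [MeasurableSpace A] [MeasurableSpace Θ] [MeasurableSpace Y]

/-- The log-likelihood ratio `log (q(y | a) / q_θ(y | a))`. -/
noncomputable def logRatio (P : LearningProblem A Θ Y) (θ : Θ) (z : A × Y) : ℝ :=
  Real.log (P.q z.1 z.2 / P.qm θ z.1 z.2)

/-- The mean of the log-likelihood ratio under the true consequence kernel. -/
noncomputable def meanLogRatio (P : LearningProblem A Θ Y) (θ : Θ) (a : A) : ℝ :=
  ∫ y, P.logRatio θ (a, y) ∂(P.Q a)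

/-- `M` bounds the likelihood ratios on the set `G`, which has full measure under the true
consequence kernel. -/
structure RatioEnvelope [TopologicalSpace Θ] (P : LearningProblem A Θ Y) (M : Y → ℝ≥0)
    (G : Set (A × Y)) : Prop where
  one_le : ∀ y, 1 ≤ M y
  measurableSet : MeasurableSet G
  ae_mem : ∀ a, ∀ᵐ y ∂(P.Q a), (a, y) ∈ G
  continuous_qm : ∀ z ∈ G, Continuous fun θ => P.qm θ z.1 z.2
  q_pos : ∀ z ∈ G, 0 < P.q z.1 z.2
  qm_le : ∀ z ∈ G, ∀ θ, P.qm θ z.1 z.2 ≤ P.q z.1 z.2 * M z.2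
  q_le : ∀ z ∈ G, ∀ θ, P.q z.1 z.2 ≤ P.qm θ z.1 z.2 * M z.2
  memLp_log : ∀ a, MemLp (fun y => Real.log (M y)) 2 (P.Q a)

lemma log_sq_le {x : ℝ} (hx : 1 ≤ x) : Real.log x ^ 2 ≤ 4 * x := by
  have h0 : 0 ≤ x := zero_le_one.trans hx
  have h1 : Real.log x = 2 * Real.log (Real.sqrt x) := by rw [Real.log_sqrt h0]; ring
  have h2 : Real.log (Real.sqrt x) ≤ Real.sqrt x := Real.log_le_self (Real.sqrt_nonneg x)
  have h3 : 0 ≤ Real.log (Real.sqrt x) := Real.log_nonneg (Real.one_le_sqrt.2 hx)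
  nlinarith [Real.sq_sqrt h0]

theorem Regular.exists_ratioEnvelope [TopologicalSpace A] [TopologicalSpace Θ]
    [TopologicalSpace.SeparableSpace Θ] [Nonempty Θ] [Countable A] [MeasurableSingletonClass A]
    {P : LearningProblem A Θ Y} (hP : P.Regular) : ∃ M G, P.RatioEnvelope M G := by
  obtain ⟨M, r, -, hM, hr, -, hM1, henv, hMr, -, -⟩ := hP.envelope
  have hcont : ∀ a, ∀ᵐ y ∂P.ν, Continuous fun θ => P.qm θ a y := fun a => by
    filter_upwards [hP.continuous_qm] with y hy
    exact hy.comp (continuous_id.prodMk continuous_const)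
  have hall : ∀ a, ∀ᵐ y ∂P.ν, ∀ θ, P.qm θ a y * (M y)⁻¹ ≤ P.q a y ∧ P.q a y ≤ P.qm θ a y * M y :=
    fun a => by
      refine ae_forall_of_denseSeq (fun θ => (henv θ a).mono fun y hy => ⟨hy.1, hy.2.1⟩) ?_
      filter_upwards [hcont a] with y hy
      have h1 : IsClosed {θ | P.qm θ a y * (M y)⁻¹ ≤ P.q a y} :=
        isClosed_le (hy.mul continuous_const) continuous_const
      have h2 : IsClosed {θ | P.q a y ≤ P.qm θ a y * M y} :=
        isClosed_le continuous_const (hy.mul continuous_const)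
      exact h1.inter h2
  let N : A → Set Y := fun a => {y | (Continuous fun θ => P.qm θ a y) ∧ 0 < P.q a y ∧
    ∀ θ, P.qm θ a y ≤ P.q a y * M y ∧ P.q a y ≤ P.qm θ a y * M y}
  have hN : ∀ a, P.Q a (N a)ᶜ = 0 := by
    intro a
    have : ∀ᵐ y ∂(P.Q a), y ∈ N a := by
      rw [P.Q_eq a, ae_withDensity_iff (P.measurable_q a).coe_nnreal_ennreal]
      filter_upwards [hcont a, hall a] with y h1 h2 h3
      have hq : 0 < P.q a y := pos_iff_ne_zero.2 (by simpa using h3)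
      refine ⟨h1, hq, fun θ => ⟨?_, (h2 θ).2⟩⟩
      have hMy : 0 < M y := zero_lt_one.trans_le (hM1 y)
      have := (h2 θ).1
      rwa [← div_eq_mul_inv, div_le_iff₀ hMy] at this
    exact this
  let T : A → Set Y := fun a => (toMeasurable (P.Q a) (N a)ᶜ)ᶜ
  have hT : ∀ a, T a ⊆ N a := fun a =>
    Set.compl_subset_comm.1 (subset_toMeasurable (P.Q a) (N a)ᶜ)
  have hTm : ∀ a, MeasurableSet (T a) := fun a => (measurableSet_toMeasurable _ _).compl
  refine ⟨M, ⋃ a, {a} ×ˢ T a, hM1, ?_, ?_, ?_, ?_, ?_, ?_, ?_⟩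
  · exact MeasurableSet.iUnion fun a => (measurableSet_singleton a).prod (hTm a)
  · intro a
    have : ∀ᵐ y ∂(P.Q a), y ∈ T a := by
      rw [ae_iff]
      change P.Q a (T a)ᶜ = 0
      rw [compl_compl, measure_toMeasurable, hN a]
    filter_upwards [this] with y hy
    simpa using hy
  · rintro ⟨a, y⟩ hz
    exact (hT a (by simpa using hz)).1
  · rintro ⟨a, y⟩ hz
    exact (hT a (by simpa using hz)).2.1
  · rintro ⟨a, y⟩ hz θ
    exact ((hT a (by simpa using hz)).2.2 θ).1
  · rintro ⟨a, y⟩ hz θ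
    exact ((hT a (by simpa using hz)).2.2 θ).2
  · intro a
    have hlog : Measurable fun y => Real.log (M y) := hM.coe_nnreal_real.log
    rw [memLp_two_iff_integrable_sq hlog.aestronglyMeasurable]
    refine ⟨(hlog.pow_const 2).aestronglyMeasurable, ?_⟩
    rw [hasFiniteIntegral_iff_ofReal (ae_of_all _ fun _ => sq_nonneg _), P.Q_eq a,
      lintegral_withDensity_eq_lintegral_mul _ (P.measurable_q a).coe_nnreal_ennreal
        (hlog.pow_const 2).ennreal_ofReal]
    refine lt_of_le_of_lt (lintegral_mono_ae (g := fun y => 4 * ((M y : ℝ≥0∞) * r y)) ?_) ?_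
    · obtain ⟨θ⟩ := ‹Nonempty Θ›
      filter_upwards [henv θ a] with y hy
      have h1 : ENNReal.ofReal (Real.log (M y) ^ 2) ≤ 4 * M y := by
        refine (ENNReal.ofReal_le_ofReal (log_sq_le (by exact_mod_cast hM1 y))).trans ?_
        rw [ENNReal.ofReal_mul (by norm_num)]
        simp
      have h2 : (P.q a y : ℝ≥0∞) ≤ r y := by exact_mod_cast hy.2.2
      calc (P.q a y : ℝ≥0∞) * ENNReal.ofReal (Real.log (M y) ^ 2) ≤ r y * (4 * M y) :=
            mul_le_mul' h2 h1
        _ = _ := by ring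
    · have hMrm : Measurable fun y => (M y : ℝ≥0∞) * r y :=
        hM.coe_nnreal_ennreal.mul hr.coe_nnreal_ennreal
      rw [lintegral_const_mul _ hMrm]
      exact ENNReal.mul_lt_top (by simp) hMr

theorem Regular.continuous_U [TopologicalSpace A] [TopologicalSpace Θ] [FirstCountableTopology Θ]
    {P : LearningProblem A Θ Y} (hP : P.Regular) (a : A) : Continuous (P.U a) := by
  obtain ⟨M, r, h, hM, hr, hh, hM1, henv, -, hpay, hint⟩ := hP.envelope
  have hqm : ∀ θ, Measurable (P.qm θ a) := fun θ =>
    P.measurable_qm.comp (measurable_const.prodMk (measurable_const.prodMk measurable_id))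
  have hU : P.U a = fun θ => ∫ y, P.qm θ a y • P.payoff a y ∂P.ν := by
    funext θ
    rw [U, P.Qm_eq, integral_withDensity_eq_integral_smul (hqm θ)]
  rw [hU]
  refine continuous_of_dominated (bound := fun y => ((h y * M y * r y : ℝ≥0) : ℝ)) ?_ ?_ ?_ ?_
  · intro θ
    exact ((hqm θ).smul (P.measurable_payoff a)).aestronglyMeasurable
  · intro θ
    filter_upwards [henv θ a, hpay a] with y h1 h2
    have hMy : 0 < M y := zero_lt_one.trans_le (hM1 y)
    have h3 : P.qm θ a y ≤ r y * M y := by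
      have := h1.1.trans h1.2.2
      rwa [← div_eq_mul_inv, div_le_iff₀ hMy] at this
    rw [NNReal.smul_def, smul_eq_mul, norm_mul, Real.norm_eq_abs, Real.norm_eq_abs,
      abs_of_nonneg (NNReal.coe_nonneg _)]
    calc (P.qm θ a y : ℝ) * |P.payoff a y| ≤ (r y * M y : ℝ≥0) * h y := by
          gcongr
      _ = _ := by push_cast; ring
  · refine ⟨((hh.mul hM).mul hr).coe_nnreal_real.aestronglyMeasurable, ?_⟩
    rw [hasFiniteIntegral_iff_ofReal (ae_of_all _ fun _ => NNReal.coe_nonneg _)]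
    simpa only [ENNReal.ofReal_coe_nnreal, ENNReal.coe_mul] using hint
  · filter_upwards [hP.continuous_qm] with y hy
    have : Continuous fun θ => P.qm θ a y := hy.comp (continuous_id.prodMk continuous_const)
    exact this.smul continuous_const

lemma measurable_logRatio [Countable A] [MeasurableSingletonClass A] (P : LearningProblem A Θ Y)
    (θ : Θ) : Measurable (P.logRatio θ) := by
  have hq : Measurable fun z : A × Y => P.q z.1 z.2 :=
    measurable_from_prod_countable_right fun a => P.measurable_q a
  have hqm : Measurable fun z : A × Y => P.qm θ z.1 z.2 :=
    P.measurable_qm.comp (measurable_const.prodMk measurable_id)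
  exact (hq.coe_nnreal_real.div hqm.coe_nnreal_real).log

lemma aestronglyMeasurable_logRatio [Countable A] [MeasurableSingletonClass A]
    (P : LearningProblem A Θ Y) (θ : Θ) (a : A) :
    AEStronglyMeasurable (fun y => P.logRatio θ (a, y)) (P.Q a) :=
  ((P.measurable_logRatio θ).comp measurable_prodMk_left).aestronglyMeasurable

namespace RatioEnvelope

variable [TopologicalSpace Θ] {P : LearningProblem A Θ Y} {M : Y → ℝ≥0} {G : Set (A × Y)}

lemma qm_pos (h : P.RatioEnvelope M G) {z : A × Y} (hz : z ∈ G) (θ : Θ) :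
    0 < P.qm θ z.1 z.2 := by
  by_contra h0
  have h1 : P.qm θ z.1 z.2 = 0 := by simpa using h0
  have h2 := h.q_le z hz θ
  rw [h1, zero_mul] at h2
  exact absurd (h.q_pos z hz) (not_lt.2 h2)

lemma log_nonneg (h : P.RatioEnvelope M G) (y : Y) : 0 ≤ Real.log (M y) :=
  Real.log_nonneg (by exact_mod_cast h.one_le y)

lemma abs_logRatio_le (h : P.RatioEnvelope M G) {z : A × Y} (hz : z ∈ G) (θ : Θ) :
    |P.logRatio θ z| ≤ Real.log (M z.2) := by
  have hqm : (0 : ℝ) < P.qm θ z.1 z.2 := by exact_mod_cast h.qm_pos hz θ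
  have hq : (0 : ℝ) < P.q z.1 z.2 := by exact_mod_cast h.q_pos z hz
  have hM : (0 : ℝ) < M z.2 := by exact_mod_cast zero_lt_one.trans_le (h.one_le z.2)
  have h1 : (P.qm θ z.1 z.2 : ℝ) ≤ P.q z.1 z.2 * M z.2 := by exact_mod_cast h.qm_le z hz θ
  have h2 : (P.q z.1 z.2 : ℝ) ≤ P.qm θ z.1 z.2 * M z.2 := by exact_mod_cast h.q_le z hz θ
  rw [abs_le, logRatio]
  constructor
  · rw [← Real.log_inv]
    refine Real.log_le_log (inv_pos.2 hM) ?_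
    rw [inv_eq_one_div, div_le_div_iff₀ hM hqm]
    linarith
  · refine Real.log_le_log (div_pos hq hqm) ?_
    rw [div_le_iff₀ hqm]
    linarith

lemma qm_eq_mul_exp (h : P.RatioEnvelope M G) {z : A × Y} (hz : z ∈ G) (θ : Θ) :
    (P.qm θ z.1 z.2 : ℝ) = P.q z.1 z.2 * Real.exp (-P.logRatio θ z) := by
  have hqm : (0 : ℝ) < P.qm θ z.1 z.2 := by exact_mod_cast h.qm_pos hz θ
  have hq : (0 : ℝ) < P.q z.1 z.2 := by exact_mod_cast h.q_pos z hz
  rw [logRatio, Real.exp_neg, Real.exp_log (div_pos hq hqm)]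
  field_simp

lemma continuous_logRatio (h : P.RatioEnvelope M G) {z : A × Y} (hz : z ∈ G) :
    Continuous fun θ => P.logRatio θ z := by
  have hqm : ∀ θ, (P.qm θ z.1 z.2 : ℝ) ≠ 0 := fun θ => by exact_mod_cast (h.qm_pos hz θ).ne'
  have hq : (P.q z.1 z.2 : ℝ) ≠ 0 := by exact_mod_cast (h.q_pos z hz).ne'
  have hc : Continuous fun θ => (P.qm θ z.1 z.2 : ℝ) :=
    NNReal.continuous_coe.comp (h.continuous_qm z hz)
  exact (continuous_const.div hc hqm).log fun θ => div_ne_zero hq (hqm θ)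

variable [Countable A] [MeasurableSingletonClass A]

lemma memLp_logRatio (h : P.RatioEnvelope M G) (θ : Θ) (a : A) :
    MemLp (fun y => P.logRatio θ (a, y)) 2 (P.Q a) := by
  refine (h.memLp_log a).of_le (P.aestronglyMeasurable_logRatio θ a) ?_
  filter_upwards [h.ae_mem a] with y hy
  exact (h.abs_logRatio_le hy θ).trans (le_abs_self _)

lemma integrable_logRatio (h : P.RatioEnvelope M G) (θ : Θ) (a : A) :
    Integrable (fun y => P.logRatio θ (a, y)) (P.Q a) :=
  (h.memLp_logRatio θ a).integrable one_le_two

lemma continuous_meanLogRatio [FirstCountableTopology Θ] (h : P.RatioEnvelope M G) (a : A) :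
    Continuous fun θ => P.meanLogRatio θ a := by
  refine continuous_of_dominated (bound := fun y => Real.log (M y))
    (fun θ => P.aestronglyMeasurable_logRatio θ a) (fun θ => ?_)
    ((h.memLp_log a).integrable one_le_two) ?_
  · filter_upwards [h.ae_mem a] with y hy using h.abs_logRatio_le hy θ
  · filter_upwards [h.ae_mem a] with y hy using h.continuous_logRatio hy

end RatioEnvelope

section Divergence

variable [TopologicalSpace A] [TopologicalSpace Θ] {P : LearningProblem A Θ Y}

lemma Regular.Q_eq_withDensity_Qm (hP : P.Regular) (θ : Θ) (a : A) :
    P.Q a = (P.Qm θ a).withDensity fun y => ((P.q a y / P.qm θ a y : ℝ≥0) : ℝ≥0∞) := by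
  obtain ⟨M, _, _, -, -, -, -, henv, -, -, -⟩ := hP.envelope
  have hqm : Measurable (P.qm θ a) :=
    P.measurable_qm.comp (measurable_const.prodMk (measurable_const.prodMk measurable_id))
  have hd : Measurable fun y => ((P.q a y / P.qm θ a y : ℝ≥0) : ℝ≥0∞) :=
    ((P.measurable_q a).div hqm).coe_nnreal_ennreal
  rw [P.Qm_eq, ← withDensity_mul _ hqm.coe_nnreal_ennreal hd, P.Q_eq]
  refine withDensity_congr_ae ?_
  filter_upwards [henv θ a] with y hy
  rw [Pi.mul_apply, ← ENNReal.coe_mul]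
  congr 1
  by_cases h0 : P.qm θ a y = 0
  · have := hy.2.1
    rw [h0, zero_mul] at this
    simp [h0, le_antisymm this zero_le]
  · rw [mul_div_cancel₀ _ h0]

lemma Regular.llr_ae_eq (hP : P.Regular) (θ : Θ) (a : A) :
    llr (P.Q a) (P.Qm θ a) =ᵐ[P.Q a] fun y => P.logRatio θ (a, y) := by
  have hqm : Measurable (P.qm θ a) :=
    P.measurable_qm.comp (measurable_const.prodMk (measurable_const.prodMk measurable_id))
  have hac : P.Q a ≪ P.Qm θ a := by
    rw [hP.Q_eq_withDensity_Qm θ a]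
    exact withDensity_absolutelyContinuous _ _
  have h1 := Measure.rnDeriv_withDensity (P.Qm θ a)
    ((P.measurable_q a).div hqm).coe_nnreal_ennreal
  have h2 : (P.Q a).rnDeriv (P.Qm θ a) =ᵐ[P.Q a]
      fun y => ((P.q a y / P.qm θ a y : ℝ≥0) : ℝ≥0∞) := by
    refine hac.ae_eq ?_
    conv_lhs => rw [hP.Q_eq_withDensity_Qm θ a]
    exact h1
  filter_upwards [h2] with y hy
  rw [llr, hy, logRatio]
  simp

lemma Regular.K_eq [Countable A] [MeasurableSingletonClass A] {M : Y → ℝ≥0} {G : Set (A × Y)}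
    (hP : P.Regular) (h : P.RatioEnvelope M G) (θ : Θ) (a : A) :
    P.K θ a ≠ ∞ ∧ (P.K θ a).toReal = P.meanLogRatio θ a := by
  have hac : P.Q a ≪ P.Qm θ a := by
    rw [hP.Q_eq_withDensity_Qm θ a]
    exact withDensity_absolutelyContinuous _ _
  have hint : Integrable (llr (P.Q a) (P.Qm θ a)) (P.Q a) :=
    (integrable_congr (hP.llr_ae_eq θ a)).2 (h.integrable_logRatio θ a)
  refine ⟨InformationTheory.klDiv_ne_top hac hint, ?_⟩
  rw [K, InformationTheory.toReal_klDiv_of_measure_eq hac (by simp)]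
  exact integral_congr_ae (hP.llr_ae_eq θ a)

end Divergence

section UniformLaw

variable [PseudoMetricSpace Θ] [TopologicalSpace.SeparableSpace Θ] [Nonempty Θ]

/-- The oscillation of the log-likelihood ratio at scale `δ`, along a dense sequence. -/
noncomputable def oscillation (P : LearningProblem A Θ Y) (δ : ℝ) (z : A × Y) : ℝ≥0∞ :=
  ⨆ i : ℕ, ⨆ j : ℕ, ⨆ _ : dist (TopologicalSpace.denseSeq Θ i) (TopologicalSpace.denseSeq Θ j) < δ,
    ENNReal.ofReal |P.logRatio (TopologicalSpace.denseSeq Θ i) z -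
      P.logRatio (TopologicalSpace.denseSeq Θ j) z|

lemma measurable_oscillation [Countable A] [MeasurableSingletonClass A]
    (P : LearningProblem A Θ Y) (δ : ℝ) : Measurable (P.oscillation δ) :=
  Measurable.iSup fun _ => Measurable.iSup fun _ => Measurable.iSup fun _ =>
    ((P.measurable_logRatio _).sub (P.measurable_logRatio _)).abs.ennreal_ofReal

lemma oscillation_le {P : LearningProblem A Θ Y} {δ : ℝ} {z : A × Y} {C : ℝ}
    (h : ∀ θ θ' : Θ, dist θ θ' < δ → |P.logRatio θ z - P.logRatio θ' z| ≤ C) :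
    P.oscillation δ z ≤ ENNReal.ofReal C :=
  iSup_le fun _ => iSup_le fun _ => iSup_le fun hd => ENNReal.ofReal_le_ofReal (h _ _ hd)

namespace RatioEnvelope

variable {P : LearningProblem A Θ Y} {M : Y → ℝ≥0} {G : Set (A × Y)}

lemma oscillation_le_log (h : P.RatioEnvelope M G) {z : A × Y} (hz : z ∈ G) (δ : ℝ) :
    P.oscillation δ z ≤ ENNReal.ofReal (2 * Real.log (M z.2)) :=
  oscillation_le fun θ θ' _ => by
    have h1 := abs_sub (P.logRatio θ z) (P.logRatio θ' z)
    linarith [h.abs_logRatio_le hz θ, h.abs_logRatio_le hz θ']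

lemma oscillation_toReal_le (h : P.RatioEnvelope M G) {z : A × Y} (hz : z ∈ G) (δ : ℝ) :
    (P.oscillation δ z).toReal ≤ 2 * Real.log (M z.2) :=
  ENNReal.toReal_le_of_le_ofReal (mul_nonneg zero_le_two (h.log_nonneg _))
    (h.oscillation_le_log hz δ)

lemma abs_sub_le_oscillation (h : P.RatioEnvelope M G) {z : A × Y} (hz : z ∈ G) {δ : ℝ}
    {θ θ' : Θ} (hd : dist θ θ' < δ) :
    |P.logRatio θ z - P.logRatio θ' z| ≤ (P.oscillation δ z).toReal := by
  have hfin : P.oscillation δ z ≠ ∞ :=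
    ((h.oscillation_le_log hz δ).trans_lt ENNReal.ofReal_lt_top).ne
  have hc : Continuous fun p : Θ × Θ => |P.logRatio p.1 z - P.logRatio p.2 z| :=
    (((h.continuous_logRatio hz).comp continuous_fst).sub
      ((h.continuous_logRatio hz).comp continuous_snd)).abs
  have h1 : IsClosed {p : Θ × Θ | δ ≤ dist p.1 p.2} := isClosed_le continuous_const continuous_dist
  have h2 : IsClosed {p : Θ × Θ |
      |P.logRatio p.1 z - P.logRatio p.2 z| ≤ (P.oscillation δ z).toReal} :=
    isClosed_le hc continuous_const
  have hden := (TopologicalSpace.denseRange_denseSeq Θ).prodMap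
    (TopologicalSpace.denseRange_denseSeq Θ)
  have hmem : (θ, θ') ∈ {p : Θ × Θ | δ ≤ dist p.1 p.2} ∪ {p : Θ × Θ |
      |P.logRatio p.1 z - P.logRatio p.2 z| ≤ (P.oscillation δ z).toReal} := by
    refine hden.induction_on (θ, θ') (h1.union h2) ?_
    rintro ⟨i, j⟩
    by_cases hij : dist (TopologicalSpace.denseSeq Θ i) (TopologicalSpace.denseSeq Θ j) < δ
    · refine Or.inr ((ENNReal.ofReal_le_iff_le_toReal hfin).1 ?_)
      exact le_iSup_of_le i (le_iSup_of_le j (le_iSup_of_le hij le_rfl))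
    · exact Or.inl (not_lt.1 hij)
  rcases hmem with h3 | h3
  · exact absurd hd (not_lt.2 h3)
  · exact h3

lemma tendsto_oscillation [CompactSpace Θ] (h : P.RatioEnvelope M G) {z : A × Y} (hz : z ∈ G) :
    Tendsto (fun n : ℕ => (P.oscillation (1 / ((n : ℝ) + 1)) z).toReal) atTop (𝓝 0) := by
  have huc : UniformContinuous fun θ => P.logRatio θ z :=
    CompactSpace.uniformContinuous_of_continuous (h.continuous_logRatio hz)
  rw [Metric.tendsto_atTop]
  intro ε hε
  obtain ⟨δ, hδ, hδ'⟩ := Metric.uniformContinuous_iff.1 huc (ε / 2) (half_pos hε)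
  obtain ⟨N, hN⟩ := exists_nat_one_div_lt hδ
  refine ⟨N, fun n hn => ?_⟩
  have h1 : (1 : ℝ) / ((n : ℝ) + 1) < δ := (Nat.one_div_le_one_div hn).trans_lt hN
  rw [Real.dist_eq, sub_zero, abs_of_nonneg ENNReal.toReal_nonneg]
  refine lt_of_le_of_lt (ENNReal.toReal_le_of_le_ofReal (half_pos hε).le
    (oscillation_le fun θ θ' hd => ?_)) (half_lt_self hε)
  have := hδ' (hd.trans h1)
  rw [Real.dist_eq] at this
  exact this.le

variable [Countable A] [MeasurableSingletonClass A]

lemma aestronglyMeasurable_oscillation (P : LearningProblem A Θ Y) (δ : ℝ) (a : A) :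
    AEStronglyMeasurable (fun y => (P.oscillation δ (a, y)).toReal) (P.Q a) :=
  ((P.measurable_oscillation δ).comp measurable_prodMk_left).ennreal_toReal.aestronglyMeasurable

lemma memLp_oscillation (h : P.RatioEnvelope M G) (δ : ℝ) (a : A) :
    MemLp (fun y => (P.oscillation δ (a, y)).toReal) 2 (P.Q a) := by
  refine ((h.memLp_log a).const_mul 2).of_le (aestronglyMeasurable_oscillation P δ a) ?_
  filter_upwards [h.ae_mem a] with y hy
  rw [Real.norm_eq_abs, abs_of_nonneg ENNReal.toReal_nonneg]
  exact (h.oscillation_toReal_le hy δ).trans (le_abs_self _)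

lemma tendsto_integral_oscillation [CompactSpace Θ] (h : P.RatioEnvelope M G) (a : A) :
    Tendsto (fun n : ℕ => ∫ y, (P.oscillation (1 / ((n : ℝ) + 1)) (a, y)).toReal ∂(P.Q a))
      atTop (𝓝 0) := by
  have := tendsto_integral_of_dominated_convergence (μ := P.Q a)
    (F := fun (n : ℕ) y => (P.oscillation (1 / ((n : ℝ) + 1)) (a, y)).toReal) (f := fun _ => 0)
    (fun y => 2 * Real.log (M y)) (fun n => aestronglyMeasurable_oscillation P _ a)
    (((h.memLp_log a).integrable one_le_two).const_mul 2)
    (fun n => by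
      filter_upwards [h.ae_mem a] with y hy
      rw [Real.norm_eq_abs, abs_of_nonneg ENNReal.toReal_nonneg]
      exact h.oscillation_toReal_le hy _)
    (by filter_upwards [h.ae_mem a] with y hy using h.tendsto_oscillation hy)
  simpa using this

lemma abs_meanLogRatio_sub_le (h : P.RatioEnvelope M G) {δ : ℝ} {θ θ' : Θ} (hd : dist θ θ' < δ)
    (a : A) : |P.meanLogRatio θ a - P.meanLogRatio θ' a| ≤
      ∫ y, (P.oscillation δ (a, y)).toReal ∂(P.Q a) := by
  rw [meanLogRatio, meanLogRatio,
    ← integral_sub (h.integrable_logRatio θ a) (h.integrable_logRatio θ' a)]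
  refine norm_integral_le_of_norm_le (f := fun y => P.logRatio θ (a, y) - P.logRatio θ' (a, y))
    ((h.memLp_oscillation δ a).integrable one_le_two) ?_
  filter_upwards [h.ae_mem a] with y hy using h.abs_sub_le_oscillation hy hd

end RatioEnvelope

/-- On a path along which the law of large numbers holds for the log-likelihood ratios at a dense
sequence and for their oscillations, it holds uniformly. -/
lemma RatioEnvelope.eventually_abs_average_le [CompactSpace Θ] [Finite A]
    [MeasurableSingletonClass A] {P : LearningProblem A Θ Y} {M : Y → ℝ≥0} {G : Set (A × Y)}
    (h : P.RatioEnvelope M G) {ω : ℕ → A × Y} (hωG : ∀ n, ω n ∈ G)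
    (hω1 : ∀ k : ℕ, Tendsto (fun n : ℕ => (∑ i ∈ Finset.range n,
      (P.logRatio (TopologicalSpace.denseSeq Θ k) (ω i) -
        P.meanLogRatio (TopologicalSpace.denseSeq Θ k) (ω i).1)) / n) atTop (𝓝 0))
    (hω2 : ∀ k : ℕ, Tendsto (fun n : ℕ => (∑ i ∈ Finset.range n,
      ((P.oscillation (1 / ((k : ℝ) + 1)) (ω i)).toReal -
        ∫ y, (P.oscillation (1 / ((k : ℝ) + 1)) ((ω i).1, y)).toReal ∂(P.Q (ω i).1))) / n)
      atTop (𝓝 0)) {η : ℝ} (hη : 0 < η) :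
    ∀ᶠ n : ℕ in atTop, ∀ θ,
      |(∑ i ∈ Finset.range n, (P.logRatio θ (ω i) - P.meanLogRatio θ (ω i).1)) / n| ≤ η := by
  obtain ⟨k, hk⟩ : ∃ k : ℕ, ∀ a,
      ∫ y, (P.oscillation (1 / ((k : ℝ) + 1)) (a, y)).toReal ∂(P.Q a) < η / 4 :=
    (eventually_all.2 fun a => (h.tendsto_integral_oscillation a).eventually_lt_const
      (show 0 < η / 4 by positivity)).exists
  have hδ : (0 : ℝ) < 1 / ((k : ℝ) + 1) := by positivity
  have h4 := (hω2 k).eventually_lt_const (show 0 < η / 4 by positivity)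
  generalize (1 : ℝ) / ((k : ℝ) + 1) = δ at hk hδ h4
  obtain ⟨I, hI⟩ : ∃ I : Finset ℕ,
      Set.univ ⊆ ⋃ i ∈ I, Metric.ball (TopologicalSpace.denseSeq Θ i) δ := by
    refine isCompact_univ.elim_finite_subcover _ (fun i => Metric.isOpen_ball) fun θ _ => ?_
    obtain ⟨i, hi⟩ := (TopologicalSpace.denseRange_denseSeq Θ).exists_dist_lt θ hδ
    exact Set.mem_iUnion.2 ⟨i, hi⟩
  have h3 : ∀ᶠ n : ℕ in atTop, ∀ j ∈ I, |(∑ i ∈ Finset.range n,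
      (P.logRatio (TopologicalSpace.denseSeq Θ j) (ω i) -
        P.meanLogRatio (TopologicalSpace.denseSeq Θ j) (ω i).1)) / n| < η / 4 := by
    rw [Filter.eventually_all_finset]
    intro j _
    have := (hω1 j).abs
    rw [abs_zero] at this
    exact this.eventually_lt_const (by positivity)
  filter_upwards [h3, h4, eventually_gt_atTop 0] with n hn3 hn4 hn0 θ
  obtain ⟨j, hjI, hj⟩ : ∃ j ∈ I, dist θ (TopologicalSpace.denseSeq Θ j) < δ := by
    simpa using hI (Set.mem_univ θ)
  have e3 := hn3 j hjI
  generalize TopologicalSpace.denseSeq Θ j = θ' at hj e3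
  have hn : (0 : ℝ) < n := by exact_mod_cast hn0
  have hterm : ∀ i, |(P.logRatio θ (ω i) - P.meanLogRatio θ (ω i).1) -
      (P.logRatio θ' (ω i) - P.meanLogRatio θ' (ω i).1)| ≤
      ((P.oscillation δ (ω i)).toReal -
        ∫ y, (P.oscillation δ ((ω i).1, y)).toReal ∂(P.Q (ω i).1)) + η / 2 := by
    intro i
    have e1 := h.abs_sub_le_oscillation (hωG i) hj
    have e2 := h.abs_meanLogRatio_sub_le hj (ω i).1
    have e3 := hk (ω i).1
    rw [abs_le] at e1 e2 ⊢
    constructor <;> linarith [e1.1, e1.2, e2.1, e2.2]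
  have hsum : |∑ i ∈ Finset.range n, (P.logRatio θ (ω i) - P.meanLogRatio θ (ω i).1) -
      ∑ i ∈ Finset.range n, (P.logRatio θ' (ω i) - P.meanLogRatio θ' (ω i).1)| ≤
      ∑ i ∈ Finset.range n, ((P.oscillation δ (ω i)).toReal -
        ∫ y, (P.oscillation δ ((ω i).1, y)).toReal ∂(P.Q (ω i).1)) + n * (η / 2) := by
    rw [← Finset.sum_sub_distrib]
    refine (Finset.abs_sum_le_sum_abs _ _).trans
      ((Finset.sum_le_sum fun i _ => hterm i).trans (le_of_eq ?_))
    rw [Finset.sum_add_distrib, Finset.sum_const, Finset.card_range, nsmul_eq_mul]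
  rw [div_lt_iff₀ hn] at hn4
  rw [abs_div, abs_of_pos hn, div_lt_iff₀ hn] at e3
  rw [abs_div, abs_of_pos hn, div_le_iff₀ hn]
  have e4 := abs_sub_abs_le_abs_sub
    (∑ i ∈ Finset.range n, (P.logRatio θ (ω i) - P.meanLogRatio θ (ω i).1))
    (∑ i ∈ Finset.range n, (P.logRatio θ' (ω i) - P.meanLogRatio θ' (ω i).1))
  linarith

/-- The uniform strong law of large numbers for the log-likelihood ratios. -/
theorem RatioEnvelope.uniform_strong_law [CompactSpace Θ] [Finite A] [MeasurableSingletonClass A]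
    {P : LearningProblem A Θ Y} {M : Y → ℝ≥0} {G : Set (A × Y)} (h : P.RatioEnvelope M G)
    (μ₀ : ProbabilityMeasure Θ) (φ : ℕ → Kernel (ProbabilityMeasure Θ) A)
    [∀ t, IsMarkovKernel (φ t)] :
    ∀ᵐ ω ∂(P.law μ₀ φ), ∀ η > 0, ∀ᶠ n : ℕ in atTop, ∀ θ,
      |(∑ i ∈ Finset.range n, (P.logRatio θ (ω i) - P.meanLogRatio θ (ω i).1)) / n| ≤ η := by
  have h1 := ae_all_iff.2 fun k : ℕ => strong_law_consequences (μ₀ := μ₀) (φ := φ)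
    (P.measurable_logRatio (TopologicalSpace.denseSeq Θ k))
    (h.memLp_logRatio (TopologicalSpace.denseSeq Θ k))
  have h2 := ae_all_iff.2 fun k : ℕ => strong_law_consequences (μ₀ := μ₀) (φ := φ)
    (P.measurable_oscillation (1 / ((k : ℝ) + 1))).ennreal_toReal
    (h.memLp_oscillation (1 / ((k : ℝ) + 1)))
  filter_upwards [h1, h2, ae_law_mem h.measurableSet h.ae_mem] with ω hω1 hω2 hωG η hη
  exact h.eventually_abs_average_le hωG hω1 hω2 hη

end UniformLaw

section Posterior

lemma bayesUpdate_coe {P : LearningProblem A Θ Y} (μ : ProbabilityMeasure Θ) {z : A × Y}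
    (hz : P.evidence μ z ≠ 0 ∧ P.evidence μ z ≠ ∞) :
    (P.bayesUpdate μ z : Measure Θ) = (P.evidence μ z)⁻¹ •
      (μ : Measure Θ).withDensity (fun θ => (P.qm θ z.1 z.2 : ℝ≥0∞)) := by
  rw [bayesUpdate, dif_pos hz]; rfl

variable [TopologicalSpace Θ] {P : LearningProblem A Θ Y} {M : Y → ℝ≥0} {G : Set (A × Y)}

lemma RatioEnvelope.evidence_ne (h : P.RatioEnvelope M G) (μ : ProbabilityMeasure Θ) {z : A × Y}
    (hz : z ∈ G) : P.evidence μ z ≠ 0 ∧ P.evidence μ z ≠ ∞ := by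
  have hm : Measurable fun θ => (P.qm θ z.1 z.2 : ℝ≥0∞) :=
    (P.measurable_qm.comp (measurable_id.prodMk measurable_const)).coe_nnreal_ennreal
  constructor
  · rw [evidence, ne_eq, lintegral_eq_zero_iff hm]
    intro h0
    obtain ⟨θ, hθ⟩ := h0.exists
    exact (h.qm_pos hz θ).ne' (by simpa using hθ)
  · refine ne_top_of_le_ne_top (b := (P.q z.1 z.2 * M z.2 : ℝ≥0)) ENNReal.coe_ne_top ?_
    refine (lintegral_mono fun θ => ENNReal.coe_le_coe.2 (h.qm_le z hz θ)).trans ?_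
    simp

/-- The posterior has a density with respect to the prior that is proportional to the exponential
of minus the cumulated log-likelihood ratio. -/
theorem RatioEnvelope.posterior_eq [Countable A] [MeasurableSingletonClass A]
    [OpensMeasurableSpace Θ] (h : P.RatioEnvelope M G) (μ₀ : ProbabilityMeasure Θ)
    {ω : ℕ → A × Y} (hω : ∀ i, ω i ∈ G) (t : ℕ) :
    ∃ c : ℝ≥0∞, (P.posterior μ₀ ω t : Measure Θ) = c • (μ₀ : Measure Θ).withDensity
      fun θ => ENNReal.ofReal (Real.exp (-∑ i ∈ Finset.range t, P.logRatio θ (ω i))) := by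
  have hc : ∀ t, Continuous fun θ => ∑ i ∈ Finset.range t, P.logRatio θ (ω i) := fun t =>
    continuous_finsetSum _ fun i _ => h.continuous_logRatio (hω i)
  have hm : ∀ t, Measurable fun θ =>
      ENNReal.ofReal (Real.exp (-∑ i ∈ Finset.range t, P.logRatio θ (ω i))) := fun t =>
    (hc t).measurable.neg.exp.ennreal_ofReal
  induction t with
  | zero => exact ⟨1, by simp [posterior]⟩
  | succ t ih =>
    obtain ⟨c, hct⟩ := ih
    have hqm : Measurable fun θ => (P.qm θ (ω t).1 (ω t).2 : ℝ≥0∞) :=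
      (P.measurable_qm.comp (measurable_id.prodMk measurable_const)).coe_nnreal_ennreal
    refine ⟨(P.evidence (P.posterior μ₀ ω t) (ω t))⁻¹ * (c * P.q (ω t).1 (ω t).2), ?_⟩
    rw [posterior, bayesUpdate_coe _ (h.evidence_ne _ (hω t)), hct, withDensity_smul_measure,
      ← withDensity_mul _ (hm t) hqm, smul_smul, mul_smul, mul_smul, mul_smul]
    congr 2
    rw [← withDensity_smul _ (hm (t + 1))]
    congr 1
    funext θ
    have e : (P.qm θ (ω t).1 (ω t).2 : ℝ≥0∞) =
        P.q (ω t).1 (ω t).2 * ENNReal.ofReal (Real.exp (-P.logRatio θ (ω t))) := by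
      rw [← ENNReal.ofReal_coe_nnreal, h.qm_eq_mul_exp (hω t) θ,
        ENNReal.ofReal_mul (NNReal.coe_nonneg _), ENNReal.ofReal_coe_nnreal]
    rw [Pi.mul_apply, Pi.smul_apply, e, smul_eq_mul, Finset.sum_range_succ, neg_add, Real.exp_add,
      ENNReal.ofReal_mul (Real.exp_nonneg _)]
    ring

end Posterior

end LearningProblem

lemma integral_empiricalActions {A Y : Type*} [MeasurableSpace A] [MeasurableSingletonClass A]
    (ω : ℕ → A × Y) (n : ℕ) (f : A → ℝ) :
    ∫ a, f a ∂(empiricalActions ω n : Measure A) =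
      (∑ i ∈ Finset.range (n + 1), f (ω i).1) / (n + 1 : ℕ) := by
  have e : (empiricalActions ω n : Measure A) =
      ((n + 1 : ℕ) : ℝ≥0∞)⁻¹ • ∑ i ∈ Finset.range (n + 1), Measure.dirac (ω i).1 := rfl
  rw [e, integral_smul_measure,
    integral_finsetSum_measure fun i _ => integrable_dirac (by simp)]
  simp only [integral_dirac, ENNReal.toReal_inv, ENNReal.toReal_natCast, smul_eq_mul]
  rw [inv_mul_eq_div]

section Concentration

variable {Θ : Type*} [MeasurableSpace Θ] [TopologicalSpace Θ] [OpensMeasurableSpace Θ]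

/-- If a probability measure has density proportional to `exp (-S)` with respect to `μ₀`, and
`S` is close to `N • g`, then it puts little mass on the points where `g` is not nearly minimal. -/
lemma measureReal_exp_tilt_le {μ₀ μ : ProbabilityMeasure Θ} {g S : Θ → ℝ} (hg : Continuous g)
    {c : ℝ≥0∞} (hμ : (μ : Measure Θ) =
      c • (μ₀ : Measure Θ).withDensity fun θ => ENNReal.ofReal (Real.exp (-S θ)))
    {N m ε : ℝ} (hN : 0 < N) (hS : ∀ θ, |S θ / N - g θ| ≤ ε / 8) :
    (μ : Measure Θ).real {θ | m + ε ≤ g θ} * (μ₀ : Measure Θ).real {θ | g θ < m + ε / 2} ≤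
      Real.exp (-(N * (ε / 4))) := by
  have hB : MeasurableSet {θ | m + ε ≤ g θ} := (isClosed_le continuous_const hg).measurableSet
  have hV : MeasurableSet {θ | g θ < m + ε / 2} := (isOpen_lt hg continuous_const).measurableSet
  set B := {θ | m + ε ≤ g θ}
  set V := {θ | g θ < m + ε / 2}
  have hS1 : ∀ θ, N * (g θ - ε / 8) ≤ S θ := fun θ => by
    have := (abs_le.1 (hS θ)).1
    have h2 : g θ - ε / 8 ≤ S θ / N := by linarith
    rw [le_div_iff₀ hN] at h2
    linarith
  have hS2 : ∀ θ, S θ ≤ N * (g θ + ε / 8) := fun θ => by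
    have := (abs_le.1 (hS θ)).2
    have h2 : S θ / N ≤ g θ + ε / 8 := by linarith
    rw [div_le_iff₀ hN] at h2
    linarith
  have h1 : (μ : Measure Θ) B ≤ c * ENNReal.ofReal (Real.exp (-(N * (m + ε - ε / 8)))) := by
    rw [hμ, Measure.smul_apply, withDensity_apply _ hB, smul_eq_mul]
    gcongr
    calc ∫⁻ θ in B, ENNReal.ofReal (Real.exp (-S θ)) ∂(μ₀ : Measure Θ)
        ≤ ∫⁻ _ in B, ENNReal.ofReal (Real.exp (-(N * (m + ε - ε / 8)))) ∂(μ₀ : Measure Θ) := by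
          refine setLIntegral_mono' hB fun θ hθ => ?_
          refine ENNReal.ofReal_le_ofReal (Real.exp_le_exp.2 (neg_le_neg ((hS1 θ).trans' ?_)))
          have : m + ε ≤ g θ := hθ
          gcongr
      _ ≤ _ := by
          rw [setLIntegral_const]
          exact mul_le_of_le_one_right zero_le prob_le_one
  have h2 : c * (ENNReal.ofReal (Real.exp (-(N * (m + ε / 2 + ε / 8)))) * (μ₀ : Measure Θ) V) ≤
      1 := by
    rw [← measure_univ (μ := (μ : Measure Θ))]
    refine le_trans ?_ (measure_mono (Set.subset_univ V))
    rw [hμ, Measure.smul_apply, withDensity_apply _ hV, smul_eq_mul, ← setLIntegral_const]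
    refine mul_le_mul_right ?_ c
    refine setLIntegral_mono' hV fun θ hθ => ?_
    refine ENNReal.ofReal_le_ofReal (Real.exp_le_exp.2 (neg_le_neg ((hS2 θ).trans ?_)))
    have : g θ < m + ε / 2 := hθ
    gcongr
  have h3 : (μ : Measure Θ) B *
      (ENNReal.ofReal (Real.exp (-(N * (m + ε / 2 + ε / 8)))) * (μ₀ : Measure Θ) V) ≤
      ENNReal.ofReal (Real.exp (-(N * (m + ε - ε / 8)))) := by
    calc _ ≤ (c * ENNReal.ofReal (Real.exp (-(N * (m + ε - ε / 8))))) *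
          (ENNReal.ofReal (Real.exp (-(N * (m + ε / 2 + ε / 8)))) * (μ₀ : Measure Θ) V) := by
            gcongr
      _ = ENNReal.ofReal (Real.exp (-(N * (m + ε - ε / 8)))) *
          (c * (ENNReal.ofReal (Real.exp (-(N * (m + ε / 2 + ε / 8)))) * (μ₀ : Measure Θ) V)) := by
            ring
      _ ≤ _ := mul_le_of_le_one_right zero_le h2
  have h4 := ENNReal.toReal_mono ENNReal.ofReal_ne_top h3
  rw [ENNReal.toReal_mul, ENNReal.toReal_mul, ENNReal.toReal_ofReal (Real.exp_nonneg _),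
    ENNReal.toReal_ofReal (Real.exp_nonneg _)] at h4
  have h5 : Real.exp (-(N * (m + ε - ε / 8))) =
      Real.exp (-(N * (ε / 4))) * Real.exp (-(N * (m + ε / 2 + ε / 8))) := by
    rw [← Real.exp_add]; congr 1; ring
  rw [h5] at h4
  refine le_of_mul_le_mul_right ?_ (Real.exp_pos (-(N * (m + ε / 2 + ε / 8))))
  calc _ = _ := by simp only [measureReal_def]; ring
    _ ≤ _ := h4

variable [CompactSpace Θ]

/-- Probability measures with densities proportional to `exp (-S n)`, where `S n / n` converges
uniformly to `g`, concentrate on the minimizers of `g`. -/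
theorem tendsto_integral_sub_min {μ₀ : ProbabilityMeasure Θ}
    (hμ₀ : (μ₀ : Measure Θ).support = Set.univ) {μ : ℕ → ProbabilityMeasure Θ} {g : Θ → ℝ}
    (hg : Continuous g) {S : ℕ → Θ → ℝ} (hμ : ∀ n, ∃ c : ℝ≥0∞, (μ n : Measure Θ) =
      c • (μ₀ : Measure Θ).withDensity fun θ => ENNReal.ofReal (Real.exp (-S n θ)))
    (hS : ∀ η > 0, ∀ᶠ n : ℕ in atTop, ∀ θ, |S n θ / n - g θ| ≤ η)
    {θ₀ : Θ} (hθ₀ : ∀ θ, g θ₀ ≤ g θ) :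
    Tendsto (fun n => ∫ θ, (g θ - g θ₀) ∂(μ n : Measure Θ)) atTop (𝓝 0) := by
  obtain ⟨D, hD⟩ : ∃ D, ∀ θ, g θ - g θ₀ ≤ D := by
    obtain ⟨D, hD⟩ := (isCompact_range
      (hg.sub continuous_const : Continuous fun θ => g θ - g θ₀)).bddAbove
    exact ⟨D, fun θ => hD ⟨θ, rfl⟩⟩
  have hD0 : 0 ≤ D := by simpa using hD θ₀
  have htail : ∀ ε > 0, Tendsto (fun n => (μ n : Measure Θ).real {θ | g θ₀ + ε ≤ g θ}) atTop
      (𝓝 0) := by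
    intro ε hε
    have hp : 0 < (μ₀ : Measure Θ).real {θ | g θ < g θ₀ + ε / 2} := by
      have h1 : θ₀ ∈ (μ₀ : Measure Θ).support := hμ₀ ▸ Set.mem_univ θ₀
      have h2 := (Measure.mem_support_iff_forall θ₀).1 h1 {θ | g θ < g θ₀ + ε / 2}
        ((isOpen_lt hg continuous_const).mem_nhds (by
          change g θ₀ < g θ₀ + ε / 2
          linarith))
      exact ENNReal.toReal_pos h2.ne' (measure_ne_top _ _)
    have hlim : Tendsto (fun n : ℕ => Real.exp (-((n : ℝ) * (ε / 4))) /
        (μ₀ : Measure Θ).real {θ | g θ < g θ₀ + ε / 2}) atTop (𝓝 0) := by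
      have := (Real.tendsto_exp_neg_atTop_nhds_zero.comp
        (tendsto_natCast_atTop_atTop.atTop_mul_const (show 0 < ε / 4 by positivity))).div_const
        ((μ₀ : Measure Θ).real {θ | g θ < g θ₀ + ε / 2})
      simpa using this
    refine squeeze_zero' (Eventually.of_forall fun n => measureReal_nonneg) ?_ hlim
    filter_upwards [hS (ε / 8) (by positivity), eventually_gt_atTop 0] with n hn hn0
    obtain ⟨c, hc⟩ := hμ n
    rw [le_div_iff₀ hp]
    exact measureReal_exp_tilt_le hg hc (by exact_mod_cast hn0) hn
  rw [Metric.tendsto_atTop']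
  intro ε hε
  have hlim := (htail (ε / 2) (half_pos hε)).const_mul D
  rw [mul_zero] at hlim
  obtain ⟨N, hN⟩ := eventually_atTop.1 (hlim.eventually_lt_const (half_pos hε))
  refine ⟨N, fun n hn => ?_⟩
  have hB : MeasurableSet {θ | g θ₀ + ε / 2 ≤ g θ} :=
    (isClosed_le continuous_const hg).measurableSet
  have hint : Integrable (fun θ => g θ - g θ₀) (μ n : Measure Θ) :=
    (BoundedContinuousFunction.mkOfCompact
      ⟨fun θ => g θ - g θ₀, hg.sub continuous_const⟩).integrable _
  have hle : ∫ θ, (g θ - g θ₀) ∂(μ n : Measure Θ) ≤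
      ∫ θ, (ε / 2 + {θ | g θ₀ + ε / 2 ≤ g θ}.indicator (fun _ => D) θ) ∂(μ n : Measure Θ) := by
    refine integral_mono hint ((integrable_const _).add ((integrable_const D).indicator hB))
      fun θ => ?_
    by_cases hθ : g θ₀ + ε / 2 ≤ g θ
    · have : θ ∈ {θ | g θ₀ + ε / 2 ≤ g θ} := hθ
      simp only [Set.indicator_of_mem this]
      linarith [hD θ]
    · have : θ ∉ {θ | g θ₀ + ε / 2 ≤ g θ} := hθ
      simp only [Set.indicator_of_notMem this]
      linarith
  rw [integral_add (integrable_const _) ((integrable_const D).indicator hB),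
    integral_indicator_const _ hB, integral_const, probReal_univ, one_smul, smul_eq_mul,
    mul_comm] at hle
  have h0 : 0 ≤ ∫ θ, (g θ - g θ₀) ∂(μ n : Measure Θ) :=
    integral_nonneg fun θ => sub_nonneg.2 (hθ₀ θ)
  rw [Real.dist_eq, sub_zero, abs_of_nonneg h0]
  linarith [hN n hn.le]

lemma tendsto_integral_of_continuous {ι : Type*} {l : Filter ι} {μ : ι → ProbabilityMeasure Θ}
    {μ' : ProbabilityMeasure Θ} (h : Tendsto μ l (𝓝 μ')) {f : Θ → ℝ} (hf : Continuous f) :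
    Tendsto (fun i => ∫ θ, f θ ∂(μ i : Measure Θ)) l (𝓝 (∫ θ, f θ ∂(μ' : Measure Θ))) :=
  (ProbabilityMeasure.tendsto_iff_forall_integral_tendsto.1 h)
    (BoundedContinuousFunction.mkOfCompact ⟨f, hf⟩)

lemma support_subset_of_integral_sub_eq_zero {μ : ProbabilityMeasure Θ} {g : Θ → ℝ}
    (hg : Continuous g) {θ₀ : Θ} (hθ₀ : ∀ θ, g θ₀ ≤ g θ)
    (h : ∫ θ, (g θ - g θ₀) ∂(μ : Measure Θ) = 0) :
    (μ : Measure Θ).support ⊆ {θ | ∀ θ', g θ ≤ g θ'} := by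
  have hint : Integrable (fun θ => g θ - g θ₀) (μ : Measure Θ) :=
    (BoundedContinuousFunction.mkOfCompact
      ⟨fun θ => g θ - g θ₀, hg.sub continuous_const⟩).integrable _
  rw [integral_eq_zero_iff_of_nonneg (fun θ => sub_nonneg.2 (hθ₀ θ)) hint] at h
  have h1 : {θ | g θ ≤ g θ₀} ∈ ae (μ : Measure Θ) := by
    filter_upwards [h] with θ hθ
    exact (sub_eq_zero.1 hθ).le
  exact (Measure.support_subset_of_isClosed (isClosed_le hg continuous_const) h1).trans
    fun θ hθ θ' => le_trans hθ (hθ₀ θ')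

end Concentration

section EmpiricalActions

variable {A Y : Type*} [MeasurableSpace A] [MeasurableSingletonClass A] [TopologicalSpace A]
  [DiscreteTopology A] [OpensMeasurableSpace A] [Finite A]
  {ω : ℕ → A × Y} {σ : ProbabilityMeasure A}

/-- An action in the support of the limiting empirical distribution is chosen infinitely often. -/
lemma frequently_action_eq (hσ : Tendsto (fun n => empiricalActions ω n) atTop (𝓝 σ)) {a : A}
    (ha : a ∈ (σ : Measure A).support) : ∃ᶠ n in atTop, (ω n).1 = a := by
  intro hne
  have hlim := tendsto_integral_of_continuous hσ
    (continuous_of_discreteTopology : Continuous (({a} : Set A).indicator fun _ => (1 : ℝ)))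
  have h0 : Tendsto (fun i => ({a} : Set A).indicator (fun _ => (1 : ℝ)) (ω i).1) atTop (𝓝 0) := by
    refine tendsto_const_nhds.congr' ?_
    filter_upwards [hne] with n hn
    simp [hn]
  have h1 := (tendsto_add_atTop_iff_nat 1).2 h0.cesaro
  have h2 := tendsto_nhds_unique (hlim.congr fun n => by
    rw [integral_empiricalActions, div_eq_inv_mul]) h1
  rw [integral_indicator_const _ (measurableSet_singleton a), smul_eq_mul, mul_one] at h2
  have h3 := (Measure.mem_support_iff_forall a).1 ha {a} (isOpen_discrete {a} |>.mem_nhds rfl)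
  exact (ENNReal.toReal_pos h3.ne' (measure_ne_top _ _)).ne' h2

/-- Empirical averages of uniformly bounded functions converge uniformly. -/
lemma eventually_abs_empirical_average_sub_le
    (hσ : Tendsto (fun n => empiricalActions ω n) atTop (𝓝 σ)) {Θ : Type*} {k : Θ → A → ℝ} {B : ℝ}
    (hB : ∀ θ a, |k θ a| ≤ B) {η : ℝ} (hη : 0 < η) :
    ∀ᶠ n : ℕ in atTop, ∀ θ, |(∑ i ∈ Finset.range n, k θ (ω i).1) / n -
      ∫ a, k θ a ∂(σ : Measure A)| ≤ η := by
  have := Fintype.ofFinite A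
  have hreal : ∀ a, Tendsto (fun n => (empiricalActions ω n : Measure A).real {a}) atTop
      (𝓝 ((σ : Measure A).real {a})) := by
    intro a
    have := tendsto_integral_of_continuous hσ
      (continuous_of_discreteTopology : Continuous (({a} : Set A).indicator fun _ => (1 : ℝ)))
    simpa [integral_indicator_const _ (measurableSet_singleton a)] using this
  have hsum : Tendsto (fun n => ∑ a, |(empiricalActions ω n : Measure A).real {a} -
      (σ : Measure A).real {a}| * B) atTop (𝓝 0) := by
    have : Tendsto (fun n => ∑ a, |(empiricalActions ω n : Measure A).real {a} -
      (σ : Measure A).real {a}| * B) atTop (𝓝 (∑ a : A, |(σ : Measure A).real {a} -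
      (σ : Measure A).real {a}| * B)) :=
      tendsto_finsetSum _ fun a _ => ((hreal a).sub_const _).abs.mul_const B
    simpa using this
  have hev : ∀ᶠ n : ℕ in atTop, ∀ θ, |(∑ i ∈ Finset.range (n + 1), k θ (ω i).1) / (n + 1 : ℕ) -
      ∫ a, k θ a ∂(σ : Measure A)| ≤ η := by
    filter_upwards [hsum.eventually_lt_const hη] with n hn θ
    rw [← integral_empiricalActions, integral_fintype .of_finite, integral_fintype .of_finite,
      ← Finset.sum_sub_distrib]
    refine (Finset.abs_sum_le_sum_abs _ _).trans ((Finset.sum_le_sum fun a _ => ?_).trans hn.le)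
    rw [smul_eq_mul, smul_eq_mul, ← sub_mul, abs_mul]
    exact mul_le_mul_of_nonneg_left (hB θ a) (abs_nonneg _)
  obtain ⟨N, hN⟩ := eventually_atTop.1 hev
  filter_upwards [eventually_ge_atTop (N + 1)] with n hn
  obtain ⟨n, rfl⟩ : ∃ j, n = j + 1 := ⟨n - 1, by omega⟩
  exact hN n (by omega)

end EmpiricalActions

namespace LearningProblem

variable {A Θ Y : Type*} [MeasurableSpace A] [MeasurableSpace Θ] [MeasurableSpace Y]
  [TopologicalSpace A] {P : LearningProblem A Θ Y}

/-- Weak identification turns separate justifications of the actions in the support of `σ` into a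
common one. -/
theorem isBerkNash_of_forall_exists [TopologicalSpace Θ] [SecondCountableTopology Θ]
    {σ : ProbabilityMeasure A} (hw : P.WeakIdentification σ)
    (hne : (P.klMinimizers σ).Nonempty) (hσ : (σ : Measure A).support.Nonempty)
    (hex : ∀ a ∈ (σ : Measure A).support, ∃ μ : ProbabilityMeasure Θ, a ∈ P.F μ ∧
      (μ : Measure Θ).support ⊆ P.klMinimizers σ) : P.IsBerkNash σ := by
  obtain ⟨θ₀, hθ₀⟩ := hne
  have hconst : ∀ μ : ProbabilityMeasure Θ, (μ : Measure Θ).support ⊆ P.klMinimizers σ →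
      ∀ a ∈ (σ : Measure A).support, ∫ θ, P.U a θ ∂(μ : Measure Θ) = P.U a θ₀ := by
    intro μ hμ a ha
    have : (P.U a) =ᵐ[(μ : Measure Θ)] fun _ => P.U a θ₀ := by
      filter_upwards [Measure.support_mem_ae (μ := (μ : Measure Θ))] with θ hθ
      rw [U, U, hw θ (hμ hθ) θ₀ hθ₀ a ha]
    rw [integral_congr_ae this]
    simp
  obtain ⟨a₀, ha₀⟩ := hσ
  obtain ⟨μ, hF, hμ⟩ := hex a₀ ha₀
  refine ⟨μ, fun a ha a' => ?_, hμ⟩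
  obtain ⟨μ', hF', hμ'⟩ := hex a ha
  have h1 := hF' a₀
  rw [hconst μ' hμ' a₀ ha₀, hconst μ' hμ' a ha] at h1
  calc ∫ θ, P.U a' θ ∂(μ : Measure Θ) ≤ ∫ θ, P.U a₀ θ ∂(μ : Measure Θ) := hF a'
    _ ≤ ∫ θ, P.U a θ ∂(μ : Measure Θ) := by rwa [hconst μ hμ a₀ ha₀, hconst μ hμ a ha]

variable [MeasurableSingletonClass A] [Finite A] {M : Y → ℝ≥0} {G : Set (A × Y)}

lemma Regular.klMinimizers_eq [TopologicalSpace Θ] (hP : P.Regular) (h : P.RatioEnvelope M G)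
    (σ : ProbabilityMeasure A) : P.klMinimizers σ =
      {θ | ∀ θ', ∫ a, P.meanLogRatio θ a ∂(σ : Measure A) ≤
        ∫ a, P.meanLogRatio θ' a ∂(σ : Measure A)} := by
  have := Fintype.ofFinite A
  have hne : ∀ θ, ∫⁻ a, P.K θ a ∂(σ : Measure A) ≠ ∞ := fun θ => by
    rw [lintegral_fintype]
    exact ENNReal.sum_ne_top.2 fun a _ => ENNReal.mul_ne_top (hP.K_eq h θ a).1 (measure_ne_top _ _)
  have hre : ∀ θ, (∫⁻ a, P.K θ a ∂(σ : Measure A)).toReal =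
      ∫ a, P.meanLogRatio θ a ∂(σ : Measure A) := fun θ => by
    rw [← integral_toReal (measurable_of_countable _).aemeasurable
      (ae_of_all _ fun a => (hP.K_eq h θ a).1.lt_top)]
    simp_rw [(hP.K_eq h θ _).2]
  ext θ
  refine forall_congr' fun θ' => ?_
  rw [← hre, ← hre, ENNReal.toReal_le_toReal (hne θ) (hne θ')]

variable [MetricSpace Θ] [CompactSpace Θ] [BorelSpace Θ] [Nonempty Θ] [DiscreteTopology A]
  [BorelSpace A]

/-- An action in the support of the limiting empirical distribution is optimal for some belief on
the minimizers of the average divergence. -/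
theorem Regular.exists_belief (hP : P.Regular) (h : P.RatioEnvelope M G)
    {μ₀ : ProbabilityMeasure Θ} (hμ₀ : (μ₀ : Measure Θ).support = Set.univ) {ω : ℕ → A × Y}
    (hωG : ∀ i, ω i ∈ G) (hωF : ∀ n, (ω n).1 ∈ P.F (P.posterior μ₀ ω n))
    (hωL : ∀ η > 0, ∀ᶠ n : ℕ in atTop, ∀ θ,
      |(∑ i ∈ Finset.range n, (P.logRatio θ (ω i) - P.meanLogRatio θ (ω i).1)) / n| ≤ η)
    {σ : ProbabilityMeasure A} (hσ : Tendsto (fun n => empiricalActions ω n) atTop (𝓝 σ)) :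
    (P.klMinimizers σ).Nonempty ∧ ∀ a ∈ (σ : Measure A).support,
      ∃ μ : ProbabilityMeasure Θ, a ∈ P.F μ ∧ (μ : Measure Θ).support ⊆ P.klMinimizers σ := by
  have := Fintype.ofFinite A
  set g : Θ → ℝ := fun θ => ∫ a, P.meanLogRatio θ a ∂(σ : Measure A) with hgdef
  have hg : Continuous g := by
    have e : g = fun θ => ∑ a, (σ : Measure A).real {a} * P.meanLogRatio θ a := by
      funext θ; exact integral_fintype .of_finite
    rw [e]
    exact continuous_finsetSum _ fun a _ => (h.continuous_meanLogRatio a).const_mul _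
  have hmin : P.klMinimizers σ = {θ | ∀ θ', g θ ≤ g θ'} := hP.klMinimizers_eq h σ
  obtain ⟨θ₀, -, hθ₀⟩ := isCompact_univ.exists_isMinOn Set.univ_nonempty hg.continuousOn
  have hθ₀ : ∀ θ, g θ₀ ≤ g θ := fun θ => hθ₀ (Set.mem_univ θ)
  obtain ⟨B, hB⟩ : ∃ B, ∀ θ a, |P.meanLogRatio θ a| ≤ B := by
    have hb : ∀ a, ∃ B, ∀ θ, |P.meanLogRatio θ a| ≤ B := fun a => by
      obtain ⟨B, hB⟩ := (isCompact_range (h.continuous_meanLogRatio a).abs).bddAbove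
      exact ⟨B, fun θ => hB ⟨θ, rfl⟩⟩
    choose B hB using hb
    exact ⟨∑ a, |B a|, fun θ a => ((hB a θ).trans (le_abs_self _)).trans
      (Finset.single_le_sum (f := fun a => |B a|) (fun _ _ => abs_nonneg _) (Finset.mem_univ a))⟩
  have hS : ∀ η > 0, ∀ᶠ n : ℕ in atTop, ∀ θ,
      |(∑ i ∈ Finset.range n, P.logRatio θ (ω i)) / n - g θ| ≤ η := by
    intro η hη
    filter_upwards [hωL (η / 2) (half_pos hη),
      eventually_abs_empirical_average_sub_le hσ hB (half_pos hη)] with n h1 h2 θ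
    have e : (∑ i ∈ Finset.range n, P.logRatio θ (ω i)) / n - g θ =
        (∑ i ∈ Finset.range n, (P.logRatio θ (ω i) - P.meanLogRatio θ (ω i).1)) / n +
        ((∑ i ∈ Finset.range n, P.meanLogRatio θ (ω i).1) / n - g θ) := by
      rw [Finset.sum_sub_distrib]; ring
    rw [e]
    exact (abs_add_le _ _).trans (by linarith [h1 θ, h2 θ])
  have hconc := tendsto_integral_sub_min hμ₀ hg (h.posterior_eq μ₀ hωG) hS hθ₀
  refine ⟨⟨θ₀, hmin ▸ hθ₀⟩, fun a ha => ?_⟩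
  have hfreq : (atTop ⊓ 𝓟 {n | (ω n).1 = a}).NeBot :=
    frequently_mem_iff_neBot.1 (frequently_action_eq hσ ha)
  let 𝒰 := Ultrafilter.of (atTop ⊓ 𝓟 {n | (ω n).1 = a})
  have h𝒰 : (𝒰 : Filter ℕ) ≤ atTop ⊓ 𝓟 {n | (ω n).1 = a} := Ultrafilter.of_le _
  obtain ⟨μ, -, hμ⟩ := isCompact_univ.ultrafilter_le_nhds
    (𝒰.map fun n => P.posterior μ₀ ω n) (by simp)
  have hμ : Tendsto (fun n => P.posterior μ₀ ω n) 𝒰 (𝓝 μ) := hμ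
  refine ⟨μ, fun a' => ?_, ?_⟩
  · refine le_of_tendsto_of_tendsto (tendsto_integral_of_continuous hμ (hP.continuous_U a'))
      (tendsto_integral_of_continuous hμ (hP.continuous_U a)) ?_
    have : ∀ᶠ n in (𝒰 : Filter ℕ), (ω n).1 = a :=
      h𝒰 (mem_inf_of_right (mem_principal_self _))
    filter_upwards [this] with n hn
    exact (hn ▸ hωF n) a'
  · rw [hmin]
    refine support_subset_of_integral_sub_eq_zero hg hθ₀ ?_
    exact tendsto_nhds_unique (tendsto_integral_of_continuous hμ (hg.sub continuous_const))
      (hconc.mono_left (h𝒰.trans inf_le_left))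

theorem Regular.ae_isBerkNash (hP : P.Regular) (μ₀ : ProbabilityMeasure Θ)
    (hμ₀ : (μ₀ : Measure Θ).support = Set.univ)
    (φ : ℕ → Kernel (ProbabilityMeasure Θ) A) [∀ t, IsMarkovKernel (φ t)]
    (hφ : P.IsOptimalSelection φ) :
    ∀ᵐ ω ∂(P.law μ₀ φ), ∀ σ : ProbabilityMeasure A,
      Tendsto (fun n => empiricalActions ω n) atTop (𝓝 σ) →
      P.WeakIdentification σ → P.IsBerkNash σ := by
  obtain ⟨M, G, h⟩ := hP.exists_ratioEnvelope
  filter_upwards [ae_law_mem h.measurableSet h.ae_mem,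
    ae_law_mem_F (fun a => (hP.continuous_U a).measurable) hφ, h.uniform_strong_law μ₀ φ]
    with ω hωG hωF hωL σ hσ hw
  obtain ⟨hne, hex⟩ := hP.exists_belief h hμ₀ hωG hωF hωL hσ
  exact isBerkNash_of_forall_exists hw hne
    (Measure.nonempty_support (IsProbabilityMeasure.ne_zero _)) hex

end LearningProblem

theorem mainTheorem6 {k d m : ℕ}
    (A : Set (EuclideanSpace ℝ (Fin k))) (Θ : Set (EuclideanSpace ℝ (Fin d)))
    (Y : Set (EuclideanSpace ℝ (Fin m)))
    (hA : A.Finite) (hA₀ : A.Nonempty)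
    (hΘ : IsCompact Θ) (hΘ₀ : Θ.Nonempty)
    (hY : MeasurableSet Y)
    (P : LearningProblem A Θ Y) (hP : P.Regular)
    (μ₀ : ProbabilityMeasure Θ) (hμ₀ : (μ₀ : Measure Θ).support = Set.univ)
    (φ : ℕ → Kernel (ProbabilityMeasure Θ) A) [∀ t, IsMarkovKernel (φ t)]
    (hφ : P.IsOptimalSelection φ) :
    ∀ᵐ ω ∂(P.law μ₀ φ), ∀ σ : ProbabilityMeasure A,
      Tendsto (fun n => empiricalActions ω n) atTop (𝓝 σ) →
      P.WeakIdentification σ → P.IsBerkNash σ := by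
  have : Finite A := hA
  have : CompactSpace Θ := isCompact_iff_compactSpace.1 hΘ
  have : Nonempty Θ := hΘ₀.to_subtype
  exact hP.ae_isBerkNash μ₀ hμ₀ φ hφ
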